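/- Let $\mathbb K$ be $\mathbb R$ or $\mathbb C$. All algebras are associative $\mathbb K$-algebras, possibly without unit. A \emph{disk} in a vector space is an absolutely convex set $S\ni 0$ with $S=\bigcap_{t>1}tS$. A \emph{separated convex bornological vector space} is a vector space $V$ with a bornology for which sums and scalar multiples of bounded sets are bounded, every bounded set lies in a bounded disk, and $\{0\}$ is the only bounded linear subspace. For a bounded disk $T$, $V_T$ is the linear span of $T$, normed by the gauge of $T$. The space $V$ is \emph{complete} if every bounded set lies in a bounded disk $T$ for which $V_T$ is a Banach space. In a \emph{convex bornological algebra}, products of bounded sets are moreover bounded. A map is \emph{bounded} if it maps bounded sets to bounded sets. A subset of $V$ is \emph{compact} if it is compact in $V_T$ for some bounded disk $T$, and \emph{relatively compact} if it lies in a compact subset. The space $V$ has the \emph{local approximation property} if for every compact disk $S\subseteq V$ there is a bounded disk $T\supseteq S$ such that the inclusion $V_S\to V_T$ is a limit, in operator norm, of a sequence of bounded finite rank operators $V_S\to V_T$. A subset $X\subseteq V$ is \emph{locally dense} if for every bounded $S\subseteq V$ there is a bounded disk $T$ with $S\subseteq T$ such that every $v\in S$ is the limit in $V_T$ of a sequence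 in $X\cap T$. The \emph{spectral radius} $\rho(S)=\rho(S;A)\in[0,\infty]$ of a subset $S$ of a bornological algebra $A$ is the infimum of all $r>0$ for which $\bigcup_{n\ge1}(r^{-1}S)^n$ is bounded; $A$ is \emph{locally multiplicative} if $\rho(S)<\infty$ for all bounded $S$. A bounded homomorphism $f\colon A\to B$ is \emph{isoradial} if $f(A)$ is locally dense in $B$ and $\rho(S;A)=\rho(f(S);B)$ for all bounded $S\subseteq A$. Let $\mathcal E([0,1],A)$ be the algebra, with pointwise operations, of all functions $[0,1]\to A$ that are $C^\infty$ as functions into the normed space $A_T$ for some bounded disk $T\subseteq A$; a subset is bounded if, for one bounded disk $T$, all its elements are smooth into $A_T$ and for each $k$ their $k$-th derivatives are uniformly bounded in $A_T$. Let $S$ be a bounded disk in a separated convex bornological algebra $D$, and let $S^{(2)}$ be the smallest disk containing $S\cup S\cdot S$. For a bornological algebra $A$, let $M(S;D,A)$ be the set of bounded linear maps $g\colon D_{S^{(2)}}\to A$ with $$\rho\bigl(\{g(xy)-g(x)g(y) : x,y\in S\};A\bigr)<1.$$ For a separated convex bornological algebra $A$, two elements $g_0,g_1\in M(S;D,A)$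 are \emph{smoothly homotopic} if there is $H\in M(S;D,\mathcal E([0,1],A))$ with $H_0=g_0$ and $H_1=g_1$; let $H(S;D,A)$ be the set of smooth homotopy classes in $M(S;D,A)$. A bounded homomorphism $f\colon A\to B$ between separated convex bornological algebras is an \emph{approximate local homotopy equivalence} (\emph{apple}) if the map $f_*\colon H(S;D,A)\to H(S;D,B)$, $[g]\mapsto[f\circ g]$, is bijective for every bounded disk $S$ in every separated convex bornological algebra $D$. \textbf{Theorem.} Let $A$ and $B$ be locally multiplicative complete separated convex bornological algebras and let $f\colon A\to B$ be an isoradial bounded homomorphism. Suppose that one of the following conditions is satisfied: (i) every bounded subset of $B$ is relatively compact and $B$ has the local approximation property; (ii) for each bounded disk $S\subseteq B$ there is a sequence of bounded linear maps $\sigma_n\colon B_S\to A$ with $(f\circ\sigma_n-\mathrm{id})(S)\to0$, that is, there are a bounded disk $T\subseteq B$ and a null sequence of scalars $(\varepsilon_n)$ with $f(\sigma_n(x))-x\in\varepsilon_nT$ for all $n$ and all $x\in S$. Then $f$ is an approximate local homotopy equivalence. -/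

import Mathlib

open Set Filter Topology Bornology
open scoped Pointwise ContDiff unitInterval

universe uK uA uB uD uV uW

/-! ## Disks and separated convex bornological vector spaces -/

section Disks

variable {V : Type uV} [AddCommGroup V]

/-- A disk: an absolutely convex set `S` with `S = ⋂_{t > 1} t S`. -/
structure IsDisk (𝕜 : Type uK) [RCLike 𝕜] [Module 𝕜 V] (S : Set V) : Prop where
  zero_mem : (0 : V) ∈ S
  absConvex : ∀ x ∈ S, ∀ y ∈ S, ∀ a b : 𝕜, ‖a‖ + ‖b‖ ≤ 1 → a • x + b • y ∈ S
  eq_iInter : S = ⋂ t ∈ Ioi (1 : ℝ), (t : 𝕜) • S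

/-- The disked hull: the smallest disk containing `S`. -/
def diskedHull (𝕜 : Type uK) [RCLike 𝕜] [Module 𝕜 V] (S : Set V) : Set V :=
  ⋂₀ {T : Set V | IsDisk 𝕜 T ∧ S ⊆ T}

variable {𝕜 : Type uK} [RCLike 𝕜] [Module 𝕜 V]

theorem IsDisk.smul_mem {S : Set V} (hS : IsDisk 𝕜 S) {x : V} (hx : x ∈ S) {a : 𝕜}
    (ha : ‖a‖ ≤ 1) : a • x ∈ S := by
  simpa using hS.absConvex x hx 0 hS.zero_mem a 0 (by simpa using ha)

theorem IsDisk.smul_subset {S : Set V} (hS : IsDisk 𝕜 S) {r s : ℝ} (hr : 0 ≤ r) (hrs : r ≤ s)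
    (hs : 0 < s) : (r : 𝕜) • S ⊆ (s : 𝕜) • S := by
  rintro _ ⟨x, hx, rfl⟩
  have hs' : (s : 𝕜) ≠ 0 := by exact_mod_cast hs.ne'
  refine ⟨((s : 𝕜)⁻¹ * (r : 𝕜)) • x, hS.smul_mem hx ?_, ?_⟩
  · rw [norm_mul, norm_inv, RCLike.norm_ofReal, RCLike.norm_ofReal, abs_of_nonneg hr,
      abs_of_pos hs, inv_mul_le_iff₀ hs]
    simpa using hrs
  · simp only [smul_smul]
    rw [mul_inv_cancel_left₀ hs']

theorem isDisk_diskedHull (S : Set V) : IsDisk 𝕜 (diskedHull 𝕜 S) where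
  zero_mem := fun _ hT => hT.1.zero_mem
  absConvex := fun x hx y hy a b hab T hT => hT.1.absConvex x (hx T hT) y (hy T hT) a b hab
  eq_iInter := by
    apply Subset.antisymm
    · intro x hx
      simp only [mem_iInter, mem_Ioi]
      intro t ht
      have ht0 : (t : 𝕜) ≠ 0 := by exact_mod_cast (zero_lt_one.trans ht).ne'
      rw [mem_smul_set_iff_inv_smul_mem₀ ht0]
      intro T hT
      refine hT.1.smul_mem (hx T hT) ?_
      rw [norm_inv, RCLike.norm_ofReal, abs_of_pos (zero_lt_one.trans ht)]
      exact inv_le_one_of_one_le₀ ht.le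
    · intro x hx T hT
      rw [hT.1.eq_iInter]
      simp only [mem_iInter, mem_Ioi] at hx ⊢
      intro t ht
      exact smul_set_mono (fun (y : V) (hy : y ∈ diskedHull 𝕜 S) => hy T hT) (hx t ht)

theorem subset_diskedHull (S : Set V) : S ⊆ diskedHull 𝕜 S := fun _ hx _ hT => hT.2 hx

theorem diskedHull_subset {S T : Set V} (hT : IsDisk 𝕜 T) (h : S ⊆ T) : diskedHull 𝕜 S ⊆ T :=
  fun _ hx => hx T ⟨hT, h⟩

end Disks

/-- A separated convex bornological vector space over `𝕜 = ℝ` or `ℂ`: a bornology for which sums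
and multiples of bounded sets are bounded, every bounded set is contained in a bounded disk, and
the only bounded linear subspace is `0`. -/
class SeparatedConvexBornologicalSpace (𝕜 : Type uK) (V : Type uV) [RCLike 𝕜] [AddCommGroup V]
    [Module 𝕜 V] [Bornology V] : Prop where
  isBounded_add : ∀ {S T : Set V}, IsBounded S → IsBounded T → IsBounded (S + T)
  isBounded_smul : ∀ (c : 𝕜) {S : Set V}, IsBounded S → IsBounded (c • S)
  exists_disk : ∀ {S : Set V}, IsBounded S → ∃ T : Set V, IsBounded T ∧ IsDisk 𝕜 T ∧ S ⊆ T
  separated : ∀ W : Submodule 𝕜 V, IsBounded (W : Set V) → W = ⊥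

/-- A separated convex bornological (associative, possibly non-unital) algebra: the product of two
bounded sets is bounded. -/
class SeparatedConvexBornologicalAlgebra (𝕜 : Type uK) (A : Type uA) [RCLike 𝕜] [NonUnitalRing A]
    [Module 𝕜 A] [IsScalarTower 𝕜 A A] [SMulCommClass 𝕜 A A] [Bornology A] : Prop
    extends SeparatedConvexBornologicalSpace 𝕜 A where
  isBounded_mul : ∀ {S T : Set A}, IsBounded S → IsBounded T → IsBounded (S * T)

/-- A map between bornological sets is bounded if it maps bounded sets to bounded sets. -/
def IsBoundedMap {V : Type uV} {W : Type uW} [Bornology V] [Bornology W] (g : V → W) : Prop :=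
  ∀ S : Set V, IsBounded S → IsBounded (g '' S)

/-- The type of bounded disks in `V`. -/
structure BoundedDisk (𝕜 : Type uK) (V : Type uV) [RCLike 𝕜] [AddCommGroup V]
    [Module 𝕜 V] [Bornology V] where
  carrier : Set V
  isDisk : IsDisk 𝕜 carrier
  isBounded : IsBounded carrier

/-! ## The normed spaces `V_T` -/

namespace BoundedDisk

section Space

variable {𝕜 : Type uK} {V : Type uV} [RCLike 𝕜] [AddCommGroup V] [Module 𝕜 V] [Bornology V]

/-- `V_T`, the linear span of the bounded disk `T`; it is normed by the gauge of `T` below. -/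
def Space (T : BoundedDisk 𝕜 V) : Type uV := Submodule.span 𝕜 T.carrier

instance (T : BoundedDisk 𝕜 V) : AddCommGroup T.Space :=
  inferInstanceAs (AddCommGroup (Submodule.span 𝕜 T.carrier))

instance (T : BoundedDisk 𝕜 V) : Module 𝕜 T.Space :=
  inferInstanceAs (Module 𝕜 (Submodule.span 𝕜 T.carrier))

/-- The inclusion `V_T → V`. -/
def val (T : BoundedDisk 𝕜 V) : T.Space →ₗ[𝕜] V := (Submodule.span 𝕜 T.carrier).subtype

theorem val_injective (T : BoundedDisk 𝕜 V) : Function.Injective T.val :=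
  Subtype.val_injective

/-- An element of `T`, viewed in `V_T`. -/
def ofMem (T : BoundedDisk 𝕜 V) (x : V) (hx : x ∈ T.carrier) : T.Space :=
  ⟨x, Submodule.subset_span hx⟩

@[simp] theorem val_ofMem (T : BoundedDisk 𝕜 V) (x : V) (hx : x ∈ T.carrier) :
    T.val (T.ofMem x hx) = x := rfl

/-- The gauge of `T`. -/
noncomputable instance (T : BoundedDisk 𝕜 V) : Norm T.Space :=
  ⟨fun x => sInf {r : ℝ | 0 < r ∧ T.val x ∈ (r : 𝕜) • T.carrier}⟩

theorem norm_def (T : BoundedDisk 𝕜 V) (x : T.Space) :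
    ‖x‖ = sInf {r : ℝ | 0 < r ∧ T.val x ∈ (r : 𝕜) • T.carrier} := rfl

theorem add_mem_smul (T : BoundedDisk 𝕜 V) {r s : ℝ} (hr : 0 < r) (hs : 0 < s) {x y : V}
    (hx : x ∈ (r : 𝕜) • T.carrier) (hy : y ∈ (s : 𝕜) • T.carrier) :
    x + y ∈ ((r + s : ℝ) : 𝕜) • T.carrier := by
  obtain ⟨x, hx, rfl⟩ := hx
  obtain ⟨y, hy, rfl⟩ := hy
  have h : 0 < r + s := add_pos hr hs
  have h' : ((r + s : ℝ) : 𝕜) ≠ 0 := by exact_mod_cast h.ne'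
  rw [mem_smul_set_iff_inv_smul_mem₀ h']
  simp only [smul_add, smul_smul]
  apply T.isDisk.absConvex x hx y hy
  simp only [norm_mul, norm_inv, RCLike.norm_ofReal, abs_of_pos h, abs_of_pos hr, abs_of_pos hs]
  rw [← mul_add, inv_mul_cancel₀ h.ne']

theorem exists_mem_smul (T : BoundedDisk 𝕜 V) (x : T.Space) :
    ∃ r : ℝ, 0 < r ∧ T.val x ∈ (r : 𝕜) • T.carrier := by
  obtain ⟨x, hx⟩ := x
  change ∃ r : ℝ, 0 < r ∧ x ∈ (r : 𝕜) • T.carrier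
  induction hx using Submodule.span_induction with
  | mem x h => exact ⟨1, one_pos, by simpa using h⟩
  | zero => exact ⟨1, one_pos, by simpa using T.isDisk.zero_mem⟩
  | add x y _ _ hx hy =>
    obtain ⟨r, hr, hx⟩ := hx
    obtain ⟨s, hs, hy⟩ := hy
    exact ⟨r + s, add_pos hr hs, T.add_mem_smul hr hs hx hy⟩
  | smul a x _ hx =>
    obtain ⟨r, hr, y, hy, rfl⟩ := hx
    have h0 : 0 < ‖a‖ + 1 := by positivity
    have h : 0 < (‖a‖ + 1) * r := by positivity
    have h' : (((‖a‖ + 1) * r : ℝ) : 𝕜) ≠ 0 := by exact_mod_cast h.ne'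
    refine ⟨(‖a‖ + 1) * r, h, ?_⟩
    rw [mem_smul_set_iff_inv_smul_mem₀ h']
    simp only [smul_smul]
    apply T.isDisk.smul_mem hy
    rw [norm_mul, norm_mul, norm_inv, RCLike.norm_ofReal, RCLike.norm_ofReal, abs_of_pos h,
      abs_of_pos hr, inv_mul_le_iff₀ h]
    nlinarith

theorem norm_nonneg' (T : BoundedDisk 𝕜 V) (x : T.Space) : 0 ≤ ‖x‖ :=
  Real.sInf_nonneg fun _ h => h.1.le

/-- `T` is the closed unit ball of `V_T`, up to scaling. -/
theorem norm_le_iff (T : BoundedDisk 𝕜 V) (x : T.Space) {r : ℝ} (hr : 0 < r) :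
    ‖x‖ ≤ r ↔ T.val x ∈ (r : 𝕜) • T.carrier := by
  constructor
  · intro h
    have hr' : (r : 𝕜) ≠ 0 := by exact_mod_cast hr.ne'
    rw [mem_smul_set_iff_inv_smul_mem₀ hr', T.isDisk.eq_iInter]
    simp only [mem_iInter, mem_Ioi]
    intro t ht
    have hlt : ‖x‖ < r * t := lt_of_le_of_lt h (by nlinarith)
    obtain ⟨s, ⟨hs0, hs⟩, hst⟩ := exists_lt_of_csInf_lt (T.exists_mem_smul x) hlt
    have := T.isDisk.smul_subset hs0.le hst.le (by positivity) hs
    rw [← mem_smul_set_iff_inv_smul_mem₀ hr', smul_smul]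
    exact_mod_cast this
  · intro h
    exact csInf_le ⟨0, fun _ h => h.1.le⟩ ⟨hr, h⟩

theorem norm_smul_le' (T : BoundedDisk 𝕜 V) (a : 𝕜) (x : T.Space) : ‖a • x‖ ≤ ‖a‖ * ‖x‖ := by
  refine le_of_forall_pos_le_add fun ε hε => ?_
  have h1 : 0 < ‖a‖ + 1 := by positivity
  set δ : ℝ := ε / (‖a‖ + 1) with hδ
  have hδ0 : 0 < δ := by positivity
  have hx0 : 0 < ‖x‖ + δ := add_pos_of_nonneg_of_pos (T.norm_nonneg' x) hδ0
  obtain ⟨y, hy, hxy⟩ := (T.norm_le_iff x hx0).1 (by linarith)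
  have hb : 0 < ‖a‖ * ‖x‖ + ε :=
    add_pos_of_nonneg_of_pos (mul_nonneg (norm_nonneg a) (T.norm_nonneg' x)) hε
  rw [T.norm_le_iff _ hb, map_smul, ← hxy]
  have h' : ((‖a‖ * ‖x‖ + ε : ℝ) : 𝕜) ≠ 0 := by exact_mod_cast hb.ne'
  rw [mem_smul_set_iff_inv_smul_mem₀ h']
  simp only [smul_smul]
  apply T.isDisk.smul_mem hy
  rw [norm_mul, norm_mul, norm_inv, RCLike.norm_ofReal, RCLike.norm_ofReal, abs_of_pos hb,
    abs_of_pos hx0, inv_mul_le_iff₀ hb]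
  have : ‖a‖ * δ ≤ ε := by
    rw [hδ, ← mul_div_assoc, div_le_iff₀ h1]
    nlinarith [norm_nonneg a]
  nlinarith

variable [SeparatedConvexBornologicalSpace 𝕜 V]

theorem normedSpaceCore (T : BoundedDisk 𝕜 V) : NormedSpace.Core 𝕜 T.Space where
  norm_nonneg := T.norm_nonneg'
  norm_smul a x := by
    refine le_antisymm (T.norm_smul_le' a x) ?_
    rcases eq_or_ne a 0 with rfl | ha
    · simpa using T.norm_nonneg' _
    · have := T.norm_smul_le' a⁻¹ (a • x)
      rw [inv_smul_smul₀ ha, norm_inv] at this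
      rwa [le_inv_mul_iff₀ (norm_pos_iff.2 ha)] at this
  norm_triangle x y := by
    refine le_of_forall_pos_le_add fun ε hε => ?_
    have hx : 0 < ‖x‖ + ε / 2 := add_pos_of_nonneg_of_pos (T.norm_nonneg' x) (by positivity)
    have hy : 0 < ‖y‖ + ε / 2 := add_pos_of_nonneg_of_pos (T.norm_nonneg' y) (by positivity)
    have := T.add_mem_smul hx hy ((T.norm_le_iff x hx).1 (by linarith))
      ((T.norm_le_iff y hy).1 (by linarith))
    rw [← map_add, ← T.norm_le_iff _ (by linarith)] at this
    linarith
  norm_eq_zero_iff x := by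
    constructor
    · intro h
      have hmem : ∀ a : 𝕜, a • T.val x ∈ T.carrier := by
        intro a
        have h1 : ‖a • x‖ ≤ 1 := by
          have := T.norm_smul_le' a x
          rw [h, mul_zero] at this
          linarith
        have := (T.norm_le_iff _ one_pos).1 h1
        simpa using this
      have hb : IsBounded ((Submodule.span 𝕜 {T.val x} : Submodule 𝕜 V) : Set V) := by
        refine T.isBounded.subset ?_
        intro y hy
        obtain ⟨a, rfl⟩ := Submodule.mem_span_singleton.1 hy
        exact hmem a
      have h0 := SeparatedConvexBornologicalSpace.separated (𝕜 := 𝕜) _ hb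
      rw [Submodule.span_singleton_eq_bot] at h0
      exact T.val_injective (by rw [h0, map_zero])
    · rintro rfl
      have := T.norm_smul_le' 0 0
      rw [zero_smul, norm_zero, zero_mul] at this
      exact le_antisymm this (T.norm_nonneg' _)

noncomputable instance (T : BoundedDisk 𝕜 V) : NormedAddCommGroup T.Space :=
  NormedAddCommGroup.ofCore T.normedSpaceCore

noncomputable instance (T : BoundedDisk 𝕜 V) : NormedSpace 𝕜 T.Space :=
  NormedSpace.ofCore T.normedSpaceCore

/-- `V_T` as a real normed space. -/
noncomputable instance (T : BoundedDisk 𝕜 V) : NormedSpace ℝ T.Space :=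
  NormedSpace.restrictScalars ℝ 𝕜 T.Space

theorem real_smul_def (T : BoundedDisk 𝕜 V) (r : ℝ) (x : T.Space) : r • x = (r : 𝕜) • x := by
  change (algebraMap ℝ 𝕜 r) • x = (r : 𝕜) • x
  rfl

instance (T : BoundedDisk 𝕜 V) : IsScalarTower ℝ 𝕜 T.Space :=
  ⟨fun r a x => by rw [real_smul_def, RCLike.real_smul_eq_coe_mul, mul_smul]⟩

end Space

end BoundedDisk

namespace BoundedDisk

section Maps

variable {𝕜 : Type uK} {V : Type uV} {W : Type uW} [RCLike 𝕜]
  [AddCommGroup V] [Module 𝕜 V] [Bornology V] [SeparatedConvexBornologicalSpace 𝕜 V]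
  [AddCommGroup W] [Module 𝕜 W] [Bornology W] [SeparatedConvexBornologicalSpace 𝕜 W]

theorem val_mem_smul_norm (T : BoundedDisk 𝕜 V) (x : T.Space) :
    T.val x ∈ ((‖x‖ : ℝ) : 𝕜) • T.carrier := by
  rcases (norm_nonneg x).eq_or_lt with h | h
  · have : x = 0 := norm_eq_zero.1 h.symm
    subst this
    exact ⟨0, T.isDisk.zero_mem, by simp⟩
  · exact (T.norm_le_iff x h).1 le_rfl

theorem norm_le_of_val_mem (T : BoundedDisk 𝕜 V) (x : T.Space) {r : ℝ} (hr : 0 ≤ r)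
    (h : T.val x ∈ (r : 𝕜) • T.carrier) : ‖x‖ ≤ r := by
  rcases hr.eq_or_lt with rfl | hr
  · obtain ⟨y, -, hy⟩ := h
    have : x = 0 := T.val_injective (by rw [← hy, map_zero]; simp)
    simp [this]
  · exact (T.norm_le_iff x hr).2 h

/-- A linear map `φ : V → W` with `φ(T) ⊆ T'` restricts to a bounded linear map `V_T → W_{T'}`. -/
noncomputable def restrict (φ : V →ₗ[𝕜] W) (T : BoundedDisk 𝕜 V) (T' : BoundedDisk 𝕜 W)
    (h : ∀ x ∈ T.carrier, φ x ∈ T'.carrier) : T.Space →L[𝕜] T'.Space :=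
  LinearMap.mkContinuous
    ((LinearMap.codRestrict (Submodule.span 𝕜 T'.carrier) (φ ∘ₗ T.val) fun x => by
      have : Submodule.span 𝕜 T.carrier ≤ (Submodule.span 𝕜 T'.carrier).comap φ :=
        Submodule.span_le.2 fun y hy => Submodule.subset_span (h y hy)
      exact this x.2 : T.Space →ₗ[𝕜] T'.Space)) 1 (by
    intro x
    rw [one_mul]
    refine T'.norm_le_of_val_mem _ (norm_nonneg x) ?_
    obtain ⟨y, hy, hxy⟩ := T.val_mem_smul_norm x
    refine ⟨φ y, h y hy, ?_⟩
    change ((‖x‖ : ℝ) : 𝕜) • φ y = φ (T.val x)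
    rw [← hxy, ← map_smul])

@[simp] theorem val_restrict (φ : V →ₗ[𝕜] W) (T : BoundedDisk 𝕜 V) (T' : BoundedDisk 𝕜 W)
    (h : ∀ x ∈ T.carrier, φ x ∈ T'.carrier) (x : T.Space) :
    T'.val (restrict φ T T' h x) = φ (T.val x) := rfl

/-- The inclusion `V_S → V_T` for bounded disks `S ⊆ T`. -/
noncomputable def inclusion {S T : BoundedDisk 𝕜 V} (h : S.carrier ⊆ T.carrier) :
    S.Space →L[𝕜] T.Space :=
  restrict LinearMap.id S T h

@[simp] theorem val_inclusion {S T : BoundedDisk 𝕜 V} (h : S.carrier ⊆ T.carrier) (x : S.Space) :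
    T.val (inclusion h x) = S.val x := rfl

theorem exists_superset {S : Set V} (hS : IsBounded S) :
    ∃ T : BoundedDisk 𝕜 V, S ⊆ T.carrier := by
  obtain ⟨T, hT, hT', h⟩ := SeparatedConvexBornologicalSpace.exists_disk (𝕜 := 𝕜) hS
  exact ⟨⟨T, hT', hT⟩, h⟩

end Maps

end BoundedDisk

/-! ## Completeness, compactness, local density, local approximation property -/

section Notions

variable (𝕜 : Type uK) {V : Type uV} [RCLike 𝕜]
  [AddCommGroup V] [Module 𝕜 V] [Bornology V] [SeparatedConvexBornologicalSpace 𝕜 V]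

variable (V) in
/-- `V` is complete: every bounded set is contained in a complete bounded disk `T`, that is, one
for which `V_T` is a Banach space. -/
def IsCompleteBornological : Prop :=
  ∀ S : Set V, IsBounded S → ∃ T : BoundedDisk 𝕜 V, CompleteSpace T.Space ∧ S ⊆ T.carrier

/-- Bornologically compact sets: compact sets in `V_T` for some bounded disk `T`. -/
def IsBornCompact (S : Set V) : Prop :=
  ∃ (T : BoundedDisk 𝕜 V) (K : Set T.Space), IsCompact K ∧ S = T.val '' K

/-- Bornologically relatively compact sets: subsets of bornologically compact sets. -/
def IsBornRelativelyCompact (S : Set V) : Prop :=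
  ∃ K : Set V, IsBornCompact 𝕜 K ∧ S ⊆ K

/-- `X` is locally dense: for any bounded `S` there is a bounded disk `T` such that any `v ∈ S` is
the limit of a `T`-convergent sequence with entries in `X ∩ T`. -/
def IsLocallyDense (X : Set V) : Prop :=
  ∀ S : Set V, IsBounded S → ∃ T : BoundedDisk 𝕜 V, ∀ v ∈ S,
    ∃ (y : T.Space) (x : ℕ → T.Space), T.val y = v ∧ v ∈ T.carrier ∧
      (∀ n, T.val (x n) ∈ X ∩ T.carrier) ∧ Tendsto x atTop (𝓝 y)

variable (V) in
/-- The local approximation property: for any compact disk `S` there is a bounded disk `T ⊇ S` such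
that the inclusion `V_S → V_T` is the norm limit of a sequence of finite rank operators. -/
def HasLocalApproximationProperty : Prop :=
  ∀ S : BoundedDisk 𝕜 V, IsBornCompact 𝕜 S.carrier →
    ∃ (T : BoundedDisk 𝕜 V) (h : S.carrier ⊆ T.carrier) (u : ℕ → S.Space →L[𝕜] T.Space),
      (∀ n, FiniteDimensional 𝕜 (LinearMap.range (u n : S.Space →ₗ[𝕜] T.Space))) ∧
      Tendsto u atTop (𝓝 (BoundedDisk.inclusion h))

/-- `u_n(S) → 0` for a sequence of maps `u_n` into `V`: there are a bounded disk `T` and a null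
sequence `(ε_n)` of scalars with `u_n(S) ⊆ ε_n T`. -/
def TendsToZeroOn {X : Type uW} (u : ℕ → X → V) (S : Set X) : Prop :=
  ∃ (T : BoundedDisk 𝕜 V) (ε : ℕ → ℝ), Tendsto ε atTop (𝓝 0) ∧
    ∀ n, ∀ x ∈ S, u n x ∈ (ε n : 𝕜) • T.carrier

end Notions

/-! ## The algebra `E([0,1], A)` of smooth functions -/

section SmoothPaths

/-- `g` exhibits `f : [0,1] → V` as a smooth function into the normed space `V_T`. Only the values
of `g` on `[0,1]` matter; derivatives are one-sided at the end points. -/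
def IsSmoothLift {𝕜 : Type uK} {V : Type uV} [RCLike 𝕜] [AddCommGroup V] [Module 𝕜 V] [Bornology V]
    [SeparatedConvexBornologicalSpace 𝕜 V] (T : BoundedDisk 𝕜 V) (f : I → V) (g : ℝ → T.Space) :
    Prop :=
  ContDiffOn ℝ ∞ g (Icc 0 1) ∧ ∀ t : I, T.val (g t) = f t

/-- Smooth functions `[0,1] → V` are those that are smooth into `V_T` for some bounded disk `T`. -/
def IsSmoothPath (𝕜 : Type uK) {V : Type uV} [RCLike 𝕜] [AddCommGroup V] [Module 𝕜 V] [Bornology V]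
    [SeparatedConvexBornologicalSpace 𝕜 V] (f : I → V) : Prop :=
  ∃ (T : BoundedDisk 𝕜 V) (g : ℝ → T.Space), IsSmoothLift T f g

/-- A set of functions is bounded in `E([0,1], V)` if, for some bounded disk `T`, it consists of
smooth functions into `V_T` with uniform bounds on each derivative. -/
def IsBoundedPathSet (𝕜 : Type uK) {V : Type uV} [RCLike 𝕜] [AddCommGroup V] [Module 𝕜 V]
    [Bornology V] [SeparatedConvexBornologicalSpace 𝕜 V] (F : Set (I → V)) : Prop :=
  ∃ (T : BoundedDisk 𝕜 V) (M : ℕ → ℝ), ∀ f ∈ F, ∃ g : ℝ → T.Space, IsSmoothLift T f g ∧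
    ∀ k : ℕ, ∀ t ∈ Icc (0 : ℝ) 1, ‖iteratedDerivWithin k g (Icc 0 1) t‖ ≤ M k

variable {𝕜 : Type uK} {V : Type uV} {W : Type uW} [RCLike 𝕜]
  [AddCommGroup V] [Module 𝕜 V] [Bornology V] [SeparatedConvexBornologicalSpace 𝕜 V]
  [AddCommGroup W] [Module 𝕜 W] [Bornology W] [SeparatedConvexBornologicalSpace 𝕜 W]

theorem IsSmoothLift.restrict {T : BoundedDisk 𝕜 V} {f : I → V} {g : ℝ → T.Space}
    (hg : IsSmoothLift T f g) (φ : V →ₗ[𝕜] W) (T' : BoundedDisk 𝕜 W)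
    (h : ∀ x ∈ T.carrier, φ x ∈ T'.carrier) :
    IsSmoothLift T' (fun t => φ (f t)) (fun t => BoundedDisk.restrict φ T T' h (g t)) := by
  refine ⟨?_, fun t => by simp [hg.2]⟩
  exact hg.1.continuousLinearMap_comp ((BoundedDisk.restrict φ T T' h).restrictScalars ℝ)

theorem exists_norm_iteratedDerivWithin_restrict_le (φ : V →ₗ[𝕜] W) (T : BoundedDisk 𝕜 V)
    (T' : BoundedDisk 𝕜 W) (h : ∀ x ∈ T.carrier, φ x ∈ T'.carrier) :
    ∃ C : ℝ, 0 ≤ C ∧ ∀ g : ℝ → T.Space, ContDiffOn ℝ ∞ g (Icc 0 1) →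
      ∀ k : ℕ, ∀ t ∈ Icc (0 : ℝ) 1,
        ‖iteratedDerivWithin k (fun t => BoundedDisk.restrict φ T T' h (g t)) (Icc 0 1) t‖ ≤
          C * ‖iteratedDerivWithin k g (Icc 0 1) t‖ := by
  set L := (BoundedDisk.restrict φ T T' h).restrictScalars ℝ
  refine ⟨‖L‖, norm_nonneg _, fun g hg k t ht => ?_⟩
  rw [← norm_iteratedFDerivWithin_eq_norm_iteratedDerivWithin,
    ← norm_iteratedFDerivWithin_eq_norm_iteratedDerivWithin]
  exact L.norm_iteratedFDerivWithin_comp_left (hg t ht) (uniqueDiffOn_Icc zero_lt_one) ht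
    (by exact_mod_cast le_top)

theorem IsBoundedPathSet.image {F : Set (I → V)} (hF : IsBoundedPathSet 𝕜 F) (φ : V →ₗ[𝕜] W)
    (hφ : IsBoundedMap φ) : IsBoundedPathSet 𝕜 ((fun f t => φ (f t)) '' F) := by
  obtain ⟨T, M, hM⟩ := hF
  obtain ⟨T', hT'⟩ := BoundedDisk.exists_superset (𝕜 := 𝕜) (hφ _ T.isBounded)
  have h : ∀ x ∈ T.carrier, φ x ∈ T'.carrier := fun x hx => hT' (mem_image_of_mem _ hx)
  obtain ⟨C, hC0, hC⟩ := exists_norm_iteratedDerivWithin_restrict_le φ T T' h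
  refine ⟨T', fun k => C * M k, ?_⟩
  rintro _ ⟨f, hf, rfl⟩
  obtain ⟨g, hg, hgM⟩ := hM f hf
  exact ⟨_, hg.restrict φ T' h, fun k t ht =>
    (hC g hg.1 k t ht).trans (mul_le_mul_of_nonneg_left (hgM k t ht) hC0)⟩

theorem isBoundedPathSet_singleton {f : I → V} (hf : IsSmoothPath 𝕜 f) :
    IsBoundedPathSet 𝕜 {f} := by
  obtain ⟨T, g, hg⟩ := hf
  have h : ∀ k : ℕ, ∃ C, ∀ t ∈ Icc (0 : ℝ) 1, ‖iteratedDerivWithin k g (Icc 0 1) t‖ ≤ C :=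
    fun k => isCompact_Icc.exists_bound_of_continuousOn
      (hg.1.continuousOn_iteratedDerivWithin (by exact_mod_cast le_top)
        (uniqueDiffOn_Icc zero_lt_one))
  choose M hM using h
  refine ⟨T, M, ?_⟩
  rintro _ rfl
  exact ⟨g, hg, hM⟩

theorem IsBoundedPathSet.isSmoothPath {F : Set (I → V)} (hF : IsBoundedPathSet 𝕜 F) {f : I → V}
    (hf : f ∈ F) : IsSmoothPath 𝕜 f := by
  obtain ⟨T, M, hM⟩ := hF
  obtain ⟨g, hg, -⟩ := hM f hf
  exact ⟨T, g, hg⟩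

theorem IsBoundedPathSet.mono_disk {F : Set (I → V)} {T T' : BoundedDisk 𝕜 V}
    (h : T.carrier ⊆ T'.carrier)
    (hF : ∃ M : ℕ → ℝ, ∀ f ∈ F, ∃ g : ℝ → T.Space, IsSmoothLift T f g ∧
      ∀ k : ℕ, ∀ t ∈ Icc (0 : ℝ) 1, ‖iteratedDerivWithin k g (Icc 0 1) t‖ ≤ M k) :
    ∃ M : ℕ → ℝ, ∀ f ∈ F, ∃ g : ℝ → T'.Space, IsSmoothLift T' f g ∧
      ∀ k : ℕ, ∀ t ∈ Icc (0 : ℝ) 1, ‖iteratedDerivWithin k g (Icc 0 1) t‖ ≤ M k := by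
  obtain ⟨M, hM⟩ := hF
  obtain ⟨C, hC0, hC⟩ := exists_norm_iteratedDerivWithin_restrict_le LinearMap.id T T' h
  refine ⟨fun k => C * M k, fun f hf => ?_⟩
  obtain ⟨g, hg, hgM⟩ := hM f hf
  exact ⟨_, hg.restrict LinearMap.id T' h, fun k t ht =>
    (hC g hg.1 k t ht).trans (mul_le_mul_of_nonneg_left (hgM k t ht) hC0)⟩

theorem IsBoundedPathSet.union {F G : Set (I → V)} (hF : IsBoundedPathSet 𝕜 F)
    (hG : IsBoundedPathSet 𝕜 G) : IsBoundedPathSet 𝕜 (F ∪ G) := by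
  obtain ⟨T₁, hF⟩ := hF
  obtain ⟨T₂, hG⟩ := hG
  obtain ⟨T, hT⟩ := BoundedDisk.exists_superset (𝕜 := 𝕜) (T₁.isBounded.union T₂.isBounded)
  obtain ⟨M, hM⟩ := IsBoundedPathSet.mono_disk (subset_union_left.trans hT) hF
  obtain ⟨N, hN⟩ := IsBoundedPathSet.mono_disk (subset_union_right.trans hT) hG
  refine ⟨T, fun k => max (M k) (N k), ?_⟩
  rintro f (hf | hf)
  · obtain ⟨g, hg, h⟩ := hM f hf
    exact ⟨g, hg, fun k t ht => (h k t ht).trans (le_max_left _ _)⟩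
  · obtain ⟨g, hg, h⟩ := hN f hf
    exact ⟨g, hg, fun k t ht => (h k t ht).trans (le_max_right _ _)⟩

/-- Two smooth functions are smooth into a common `V_T`. -/
theorem IsSmoothPath.exists_common {f₁ f₂ : I → V} (h₁ : IsSmoothPath 𝕜 f₁)
    (h₂ : IsSmoothPath 𝕜 f₂) : ∃ (T : BoundedDisk 𝕜 V) (g₁ g₂ : ℝ → T.Space),
      IsSmoothLift T f₁ g₁ ∧ IsSmoothLift T f₂ g₂ := by
  obtain ⟨T, M, hM⟩ := (isBoundedPathSet_singleton h₁).union (isBoundedPathSet_singleton h₂)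
  obtain ⟨g₁, hg₁, -⟩ := hM f₁ (Or.inl rfl)
  obtain ⟨g₂, hg₂, -⟩ := hM f₂ (Or.inr rfl)
  exact ⟨T, g₁, g₂, hg₁, hg₂⟩

theorem IsSmoothPath.add {f₁ f₂ : I → V} (h₁ : IsSmoothPath 𝕜 f₁) (h₂ : IsSmoothPath 𝕜 f₂) :
    IsSmoothPath 𝕜 (f₁ + f₂) := by
  obtain ⟨T, g₁, g₂, hg₁, hg₂⟩ := h₁.exists_common h₂
  exact ⟨T, fun t => g₁ t + g₂ t, hg₁.1.add hg₂.1, fun t => by simp [hg₁.2, hg₂.2]⟩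

theorem IsSmoothPath.smul {f : I → V} (h : IsSmoothPath 𝕜 f) (c : 𝕜) : IsSmoothPath 𝕜 (c • f) := by
  obtain ⟨T, g, hg⟩ := h
  refine ⟨T, fun t => c • g t, ?_, fun t => by simp [hg.2]⟩
  exact hg.1.continuousLinearMap_comp
    ((c • ContinuousLinearMap.id 𝕜 T.Space).restrictScalars ℝ)

theorem IsSmoothPath.zero : IsSmoothPath 𝕜 (0 : I → V) := by
  obtain ⟨T, -⟩ := BoundedDisk.exists_superset (𝕜 := 𝕜) (V := V) (isBounded_empty)
  exact ⟨T, fun _ => 0, contDiffOn_const, fun t => by simp⟩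

end SmoothPaths

section SmoothPathAlgebra

variable {𝕜 : Type uK} {A : Type uA} {B : Type uB} [RCLike 𝕜]
  [NonUnitalRing A] [Module 𝕜 A] [IsScalarTower 𝕜 A A] [SMulCommClass 𝕜 A A] [Bornology A]
  [SeparatedConvexBornologicalAlgebra 𝕜 A]
  [NonUnitalRing B] [Module 𝕜 B] [IsScalarTower 𝕜 B B] [SMulCommClass 𝕜 B B] [Bornology B]
  [SeparatedConvexBornologicalAlgebra 𝕜 B]

theorem IsSmoothPath.mul {f₁ f₂ : I → A} (h₁ : IsSmoothPath 𝕜 f₁) (h₂ : IsSmoothPath 𝕜 f₂) :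
    IsSmoothPath 𝕜 (f₁ * f₂) := by
  obtain ⟨T, g₁, g₂, hg₁, hg₂⟩ := h₁.exists_common h₂
  obtain ⟨T', hT'⟩ := BoundedDisk.exists_superset (𝕜 := 𝕜)
    (SeparatedConvexBornologicalAlgebra.isBounded_mul (𝕜 := 𝕜) T.isBounded T.isBounded)
  have key : ∀ x y : T.Space,
      T.val x * T.val y ∈ ((‖x‖ * ‖y‖ : ℝ) : 𝕜) • T'.carrier := by
    intro x y
    obtain ⟨x', hx', hx⟩ := T.val_mem_smul_norm x
    obtain ⟨y', hy', hy⟩ := T.val_mem_smul_norm y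
    refine ⟨x' * y', hT' (mul_mem_mul hx' hy'), ?_⟩
    rw [← hx, ← hy]
    simp only [smul_mul_smul_comm, RCLike.ofReal_mul]
  have hspan : ∀ x y : T.Space, T.val x * T.val y ∈ Submodule.span 𝕜 T'.carrier := by
    intro x y
    obtain ⟨z, hz, hxy⟩ := key x y
    rw [← hxy]
    exact Submodule.smul_mem _ _ (Submodule.subset_span hz)
  let m : T.Space → T.Space → T'.Space := fun x y => ⟨T.val x * T.val y, hspan x y⟩
  have hm : ∀ x y, T'.val (m x y) = T.val x * T.val y := fun _ _ => rfl
  let b : T.Space →ₗ[𝕜] T.Space →ₗ[𝕜] T'.Space := LinearMap.mk₂ 𝕜 m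
    (fun x y z => T'.val_injective (by simp only [hm, map_add, add_mul]))
    (fun c x y => T'.val_injective (by simp only [hm, map_smul, smul_mul_assoc]))
    (fun x y z => T'.val_injective (by simp only [hm, map_add, mul_add]))
    (fun c x y => T'.val_injective (by simp only [hm, map_smul, mul_smul_comm]))
  let β : T.Space →L[𝕜] T.Space →L[𝕜] T'.Space := b.mkContinuous₂ 1 (fun x y => by
    rw [one_mul]
    exact T'.norm_le_of_val_mem _ (by positivity) (key x y))
  have hβ : IsBoundedBilinearMap ℝ (fun p : T.Space × T.Space => β p.1 p.2) :=
    { add_left := fun x y z => by simp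
      smul_left := fun c x y => by
        rw [T.real_smul_def, T'.real_smul_def]
        exact β.map_smul₂ _ x y
      add_right := fun x y z => by simp
      smul_right := fun c x y => by
        rw [T.real_smul_def, T'.real_smul_def]
        exact map_smul (β x) _ y
      bound := β.isBoundedBilinearMap.bound }
  refine ⟨T', fun t => β (g₁ t) (g₂ t), ?_, fun t => ?_⟩
  · exact hβ.contDiff.comp_contDiffOn (hg₁.1.prodMk hg₂.1)
  · change T.val (g₁ t) * T.val (g₂ t) = _
    rw [hg₁.2, hg₂.2]
    rfl

variable (𝕜 A) in
/-- The smooth functions `[0,1] → A` as a subalgebra of all functions. -/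
def smoothPathSubalgebra : NonUnitalSubalgebra 𝕜 (I → A) where
  carrier := {f | IsSmoothPath 𝕜 f}
  add_mem' := IsSmoothPath.add
  zero_mem' := IsSmoothPath.zero
  mul_mem' := IsSmoothPath.mul
  smul_mem' := fun c _ h => IsSmoothPath.smul h c

variable (𝕜 A) in
/-- The algebra `E([0,1], A)` with pointwise operations. Its bornology is defined below; it is not
the one induced from the product bornology on all functions. -/
def SmoothPath : Type uA := smoothPathSubalgebra 𝕜 A

namespace SmoothPath

instance : NonUnitalRing (SmoothPath 𝕜 A) :=
  inferInstanceAs (NonUnitalRing (smoothPathSubalgebra 𝕜 A))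

instance : Module 𝕜 (SmoothPath 𝕜 A) :=
  inferInstanceAs (Module 𝕜 (smoothPathSubalgebra 𝕜 A))

/-- The underlying function `[0,1] → A`. -/
def toFun (f : SmoothPath 𝕜 A) : I → A := f.1

theorem toFun_injective : Function.Injective (toFun : SmoothPath 𝕜 A → I → A) :=
  Subtype.val_injective

/-- The bornology of `E([0,1], A)`. -/
instance : Bornology (SmoothPath 𝕜 A) :=
  Bornology.ofBounded {F | IsBoundedPathSet 𝕜 (toFun '' F)}
    (by
      obtain ⟨T, -⟩ := BoundedDisk.exists_superset (𝕜 := 𝕜) (V := A) (isBounded_empty)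
      exact ⟨T, 0, by simp⟩)
    (by
      rintro F ⟨T, M, h⟩ G hG
      exact ⟨T, M, fun f hf => h f (image_mono hG hf)⟩)
    (by
      intro F hF G hG
      change IsBoundedPathSet 𝕜 (toFun '' (F ∪ G))
      rw [image_union]
      exact IsBoundedPathSet.union hF hG)
    (by
      intro f
      change IsBoundedPathSet 𝕜 (toFun '' {f})
      rw [image_singleton]
      exact isBoundedPathSet_singleton f.2)

theorem isBounded_iff (F : Set (SmoothPath 𝕜 A)) :
    IsBounded F ↔ IsBoundedPathSet 𝕜 (toFun '' F) :=
  Bornology.isBounded_ofBounded_iff _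

/-- A bounded homomorphism `A → B` induces a homomorphism `E([0,1], A) → E([0,1], B)`. -/
def map (f : A →ₙₐ[𝕜] B) (hf : IsBoundedMap f) : SmoothPath 𝕜 A →ₙₐ[𝕜] SmoothPath 𝕜 B where
  toFun p := ⟨fun t => f (p.toFun t),
    ((isBoundedPathSet_singleton p.2).image (f : A →ₗ[𝕜] B) hf).isSmoothPath
      (mem_image_of_mem _ rfl)⟩
  map_smul' c p := toFun_injective (funext fun t => map_smul f c (p.toFun t))
  map_zero' := toFun_injective (funext fun _ => map_zero f)
  map_add' p q := toFun_injective (funext fun t => map_add f (p.toFun t) (q.toFun t))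
  map_mul' p q := toFun_injective (funext fun t => map_mul f (p.toFun t) (q.toFun t))

@[simp] theorem toFun_map (f : A →ₙₐ[𝕜] B) (hf : IsBoundedMap f) (p : SmoothPath 𝕜 A) (t : I) :
    (map f hf p).toFun t = f (p.toFun t) := rfl

theorem isBoundedMap_map (f : A →ₙₐ[𝕜] B) (hf : IsBoundedMap f) : IsBoundedMap (map f hf) := by
  intro F hF
  rw [isBounded_iff] at hF ⊢
  have := hF.image (f : A →ₗ[𝕜] B) hf
  rw [image_image] at this ⊢
  exact this

end SmoothPath

end SmoothPathAlgebra

/-! ## Spectral radius, local multiplicativity, isoradial homomorphisms -/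

section SpectralRadius

/-- The spectral radius `ρ(S) ∈ [0, ∞]`: the infimum of all `r > 0` for which
`(r⁻¹ S)^∞ = ⋃_{n ≥ 1} (r⁻¹ S)^n`, the multiplicative semigroup generated by `r⁻¹ S`, is bounded. -/
noncomputable def bornSpectralRadius (𝕜 : Type uK) {A : Type uA} [RCLike 𝕜] [NonUnitalRing A]
    [Module 𝕜 A] [Bornology A] (S : Set A) : ENNReal :=
  ⨅ (r : ℝ) (_ : 0 < r) (_ : IsBounded (Subsemigroup.closure ((r : 𝕜)⁻¹ • S) : Set A)),
    ENNReal.ofReal r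

/-- Every bounded set has finite spectral radius. -/
def IsLocallyMultiplicative (𝕜 : Type uK) (A : Type uA) [RCLike 𝕜] [NonUnitalRing A]
    [Module 𝕜 A] [Bornology A] : Prop :=
  ∀ S : Set A, IsBounded S → bornSpectralRadius 𝕜 S < ⊤

theorem bornSpectralRadius_image_le {𝕜 : Type uK} {A : Type uA} {B : Type uB} [RCLike 𝕜]
    [NonUnitalRing A] [Module 𝕜 A] [Bornology A] [NonUnitalRing B] [Module 𝕜 B] [Bornology B]
    (f : A →ₙₐ[𝕜] B) (hf : IsBoundedMap f) (S : Set A) :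
    bornSpectralRadius 𝕜 (f '' S) ≤ bornSpectralRadius 𝕜 S := by
  refine le_iInf₂ fun r hr => le_iInf fun h => iInf₂_le_of_le r hr (iInf_le_of_le ?_ le_rfl)
  refine (hf _ h).subset ?_
  have h1 : (r : 𝕜)⁻¹ • (f '' S) = f '' ((r : 𝕜)⁻¹ • S) := by
    rw [image_smul_comm]
    intro x
    exact map_smul f _ x
  rw [h1]
  exact (MulHom.map_mclosure (f : A →ₙ* B) ((r : 𝕜)⁻¹ • S)).symm.le

/-- A bounded homomorphism `f` is isoradial if `f(A)` is locally dense and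
`ρ(S; A) = ρ(f(S); B)` for all bounded `S ⊆ A`. -/
def IsIsoradial {𝕜 : Type uK} {A : Type uA} {B : Type uB} [RCLike 𝕜]
    [NonUnitalRing A] [Module 𝕜 A] [Bornology A]
    [NonUnitalRing B] [Module 𝕜 B] [Bornology B] [SeparatedConvexBornologicalSpace 𝕜 B]
    (f : A →ₙₐ[𝕜] B) : Prop :=
  IsLocallyDense 𝕜 (range f) ∧
    ∀ S : Set A, IsBounded S → bornSpectralRadius 𝕜 S = bornSpectralRadius 𝕜 (f '' S)

end SpectralRadius

/-! ## Approximately multiplicative maps and smooth homotopy -/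

section Homotopy

variable {𝕜 : Type uK} {D : Type uD} [RCLike 𝕜]
  [NonUnitalRing D] [Module 𝕜 D] [IsScalarTower 𝕜 D D] [SMulCommClass 𝕜 D D] [Bornology D]
  [SeparatedConvexBornologicalAlgebra 𝕜 D]

/-- `S^{(2)}`, the disked hull of `S ∪ S · S`. -/
def BoundedDisk.two (S : BoundedDisk 𝕜 D) : BoundedDisk 𝕜 D where
  carrier := diskedHull 𝕜 (S.carrier ∪ S.carrier * S.carrier)
  isDisk := isDisk_diskedHull _
  isBounded := by
    obtain ⟨T, hT⟩ := BoundedDisk.exists_superset (𝕜 := 𝕜) (S.isBounded.union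
      (SeparatedConvexBornologicalAlgebra.isBounded_mul (𝕜 := 𝕜) S.isBounded S.isBounded))
    exact T.isBounded.subset (diskedHull_subset T.isDisk hT)

theorem BoundedDisk.mem_two {S : BoundedDisk 𝕜 D} {x : D} (hx : x ∈ S.carrier) :
    x ∈ S.two.carrier :=
  subset_diskedHull _ (Or.inl hx)

theorem BoundedDisk.mul_mem_two {S : BoundedDisk 𝕜 D} {x y : D} (hx : x ∈ S.carrier)
    (hy : y ∈ S.carrier) : x * y ∈ S.two.carrier :=
  subset_diskedHull _ (Or.inr (mul_mem_mul hx hy))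

/-- `ω_g(S, S)`, the set of all `ω_g(x, y) = g(xy) - g(x) g(y)` with `x, y ∈ S`. -/
def curvatureSet {A : Type uA} [NonUnitalRing A] [Module 𝕜 A] (S : BoundedDisk 𝕜 D)
    (g : S.two.Space →ₗ[𝕜] A) : Set A :=
  {a | ∃ (x y : D) (hx : x ∈ S.carrier) (hy : y ∈ S.carrier),
    a = g (S.two.ofMem (x * y) (BoundedDisk.mul_mem_two hx hy)) -
      g (S.two.ofMem x (BoundedDisk.mem_two hx)) * g (S.two.ofMem y (BoundedDisk.mem_two hy))}

/-- `M(S; D, A)`: the bounded linear maps `g : D_{S^{(2)}} → A` with `ρ(ω_g(S, S); A) < 1`. -/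
structure ApproxMultMap (S : BoundedDisk 𝕜 D) (A : Type uA) [NonUnitalRing A] [Module 𝕜 A]
    [Bornology A] where
  toLin : S.two.Space →ₗ[𝕜] A
  isBoundedMap : IsBoundedMap toLin
  curvature_lt_one : bornSpectralRadius 𝕜 (curvatureSet S toLin) < 1

/-- Composition of approximately multiplicative maps with a bounded homomorphism. -/
def ApproxMultMap.map {S : BoundedDisk 𝕜 D} {A : Type uA} {B : Type uB} [NonUnitalRing A]
    [Module 𝕜 A] [Bornology A] [NonUnitalRing B] [Module 𝕜 B] [Bornology B]
    (f : A →ₙₐ[𝕜] B) (hf : IsBoundedMap f) (g : ApproxMultMap S A) : ApproxMultMap S B where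
  toLin := (f : A →ₗ[𝕜] B) ∘ₗ g.toLin
  isBoundedMap := fun s hs => by
    have := hf _ (g.isBoundedMap s hs)
    rw [image_image] at this
    exact this
  curvature_lt_one := by
    have h : curvatureSet S ((f : A →ₗ[𝕜] B) ∘ₗ g.toLin) = f '' curvatureSet S g.toLin := by
      ext b
      constructor
      · rintro ⟨x, y, hx, hy, rfl⟩
        exact ⟨_, ⟨x, y, hx, hy, rfl⟩, by simp⟩
      · rintro ⟨_, ⟨x, y, hx, hy, rfl⟩, rfl⟩
        exact ⟨x, y, hx, hy, by simp⟩
    rw [h]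
    exact (bornSpectralRadius_image_le f hf _).trans_lt g.curvature_lt_one

variable {A : Type uA} {B : Type uB}
  [NonUnitalRing A] [Module 𝕜 A] [IsScalarTower 𝕜 A A] [SMulCommClass 𝕜 A A] [Bornology A]
  [SeparatedConvexBornologicalAlgebra 𝕜 A]
  [NonUnitalRing B] [Module 𝕜 B] [IsScalarTower 𝕜 B B] [SMulCommClass 𝕜 B B] [Bornology B]
  [SeparatedConvexBornologicalAlgebra 𝕜 B]

/-- `g₀` and `g₁` are smoothly homotopic: there is `H ∈ M(S; D, E([0,1], A))` with `H_0 = g₀` and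
`H_1 = g₁`. -/
def SmoothlyHomotopic {S : BoundedDisk 𝕜 D} (g₀ g₁ : ApproxMultMap S A) : Prop :=
  ∃ H : ApproxMultMap S (SmoothPath 𝕜 A),
    (∀ x, (H.toLin x).toFun 0 = g₀.toLin x) ∧ (∀ x, (H.toLin x).toFun 1 = g₁.toLin x)

/-- `H(S; D, A)`: smooth homotopy classes of approximately multiplicative maps, that is, classes of
the equivalence relation generated by smooth homotopy (which is itself an equivalence relation). -/
def HomotopyClasses (S : BoundedDisk 𝕜 D) (A : Type uA) [NonUnitalRing A] [Module 𝕜 A]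
    [IsScalarTower 𝕜 A A] [SMulCommClass 𝕜 A A] [Bornology A]
    [SeparatedConvexBornologicalAlgebra 𝕜 A] : Type (max uD uA) :=
  Quot (SmoothlyHomotopic : ApproxMultMap S A → ApproxMultMap S A → Prop)

/-- The induced map `f_* : H(S; D, A) → H(S; D, B)`. -/
def HomotopyClasses.map (S : BoundedDisk 𝕜 D) (f : A →ₙₐ[𝕜] B) (hf : IsBoundedMap f) :
    HomotopyClasses S A → HomotopyClasses S B :=
  Quot.map (ApproxMultMap.map f hf) (by
    rintro g₀ g₁ ⟨H, h0, h1⟩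
    refine ⟨H.map (SmoothPath.map f hf) (SmoothPath.isBoundedMap_map f hf), fun x => ?_,
      fun x => ?_⟩
    · exact congrArg f (h0 x)
    · exact congrArg f (h1 x))

end Homotopy

/-- `f` is an approximate local homotopy equivalence: `f_* : H(S; D, A) → H(S; D, B)` is bijective
for every bounded disk `S` in every separated convex bornological algebra `D`. -/
def IsApproxLocalHomotopyEquiv {𝕜 : Type uK} {A : Type uA} {B : Type uB} [RCLike 𝕜]
    [NonUnitalRing A] [Module 𝕜 A] [IsScalarTower 𝕜 A A] [SMulCommClass 𝕜 A A] [Bornology A]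
    [SeparatedConvexBornologicalAlgebra 𝕜 A]
    [NonUnitalRing B] [Module 𝕜 B] [IsScalarTower 𝕜 B B] [SMulCommClass 𝕜 B B] [Bornology B]
    [SeparatedConvexBornologicalAlgebra 𝕜 B]
    (f : A →ₙₐ[𝕜] B) (hf : IsBoundedMap f) : Prop :=
  ∀ (D : Type uD) [NonUnitalRing D] [Module 𝕜 D] [IsScalarTower 𝕜 D D] [SMulCommClass 𝕜 D D]
    [Bornology D] [SeparatedConvexBornologicalAlgebra 𝕜 D] (S : BoundedDisk 𝕜 D),
    Function.Bijective (HomotopyClasses.map S f hf)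

/-!
If `f : A → B` preserves spectral radii, then whether a bounded linear map `g` into `A` is
approximately multiplicative depends only on `f ∘ g`. The theorem therefore reduces to a
perturbation argument, which produces an inverse of `f_*` by sending the class of `h` to the class
of any `g` for which `f ∘ g` is sufficiently near `h`.

* *Such maps `g` exist* (`HasApproximateLifts`). Under condition (ii) they are the compositions
  `σ_n ∘ h`. Condition (i) implies the same: each bounded disk of `B` lies in a compact disk
  `P` (`IsBornRelativelyCompact.exists_compact_disk`), the inclusion of `B_P` is a limit of finite
  rank operators, and a finite rank operator lifts approximately to `A` because `f(A)` is locally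
  dense (`HasLocalApproximationProperty.hasApproximateLifts`).
* *The condition `ρ < 1` is open.* In a locally multiplicative algebra, a bounded multiplicative
  semigroup stays bounded if a small multiple of a bounded set is added to its generators. Hence a
  set `X` with `ρ(X) < 1` lies in a ball of radius less than one in a normed algebra `A_T`, where
  the bounded disk `T` may be chosen to absorb any given bounded set
  (`IsLocallyMultiplicative.exists_multiplicative_disk`). So maps near an approximately
  multiplicative map are approximately multiplicative
  (`IsLocallyMultiplicative.exists_curvature_lt_one_of_isNear`).
* *The condition `ρ < 1` is pointwise for paths.* A bounded subset of `E([0,1], A)` has spectral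
  radius less than one if its evaluations at all points do
  (`IsLocallyMultiplicative.bornSpectralRadius_smoothPath_lt_one`). Near a point, the paths in the
  set have norm at most some `q < 1` in a normed algebra `A_T`. By the Leibniz rule, the bounds
  `Λ k` on `k`-th derivatives of products persist under multiplication by a further factor if
  `q Λ k` plus a combination of the `Λ i` with `i < k` is at most `Λ k`, and such `Λ` are found
  recursively. Compactness of the interval gives a global estimate.

Consequently two lifts that are sufficiently near the same `h` are linearly homotopic
(`exists_linearHomotopy_of_isNear`), and lifting a homotopy `H` into `E([0,1], B)` pointwise gives a
homotopy between lifts of its end points (`HasApproximateLifts.exists_lift`). So the class of lifts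
is an invariant of the homotopy class of `h`, and it is inverse to `f_*`
(`HasApproximateLifts.bijective_map`).
-/

/-! ### Disks and the normed spaces they span -/

section DiskMaps

variable {𝕜 : Type uK} {V : Type uV} {W : Type uW} [RCLike 𝕜]
  [AddCommGroup V] [Module 𝕜 V] [AddCommGroup W] [Module 𝕜 W]

theorem IsDisk.preimage {T : Set W} (hT : IsDisk 𝕜 T) (φ : V →ₗ[𝕜] W) :
    IsDisk 𝕜 (φ ⁻¹' T) where
  zero_mem := by simpa using hT.zero_mem
  absConvex x hx y hy a b hab := by
    simpa using hT.absConvex _ hx _ hy a b hab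
  eq_iInter := by
    have key : ∀ (x : V) (t : ℝ), 1 < t →
        (x ∈ (t : 𝕜) • (φ ⁻¹' T) ↔ φ x ∈ (t : 𝕜) • T) := by
      intro x t ht
      have ht0 : (t : 𝕜) ≠ 0 := by exact_mod_cast (zero_lt_one.trans ht).ne'
      rw [mem_smul_set_iff_inv_smul_mem₀ ht0, mem_smul_set_iff_inv_smul_mem₀ ht0, mem_preimage,
        map_smul]
    ext x
    have hx : φ x ∈ T ↔ ∀ t : ℝ, 1 < t → φ x ∈ (t : 𝕜) • T := by
      conv_lhs => rw [hT.eq_iInter]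
      simp only [mem_iInter, mem_Ioi]
    rw [mem_preimage, hx]
    simp only [mem_iInter, mem_Ioi]
    exact forall₂_congr fun t ht => (key x t ht).symm

theorem diskedHull_mul_subset {A : Type uA} [NonUnitalRing A] [Module 𝕜 A] [IsScalarTower 𝕜 A A]
    [SMulCommClass 𝕜 A A] (P Q : Set A) :
    diskedHull 𝕜 P * diskedHull 𝕜 Q ⊆ diskedHull 𝕜 (P * Q) := by
  have hl : ∀ x ∈ diskedHull 𝕜 P, ∀ y ∈ Q, x * y ∈ diskedHull 𝕜 (P * Q) := by
    intro x hx y hy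
    exact diskedHull_subset ((isDisk_diskedHull (𝕜 := 𝕜) (P * Q)).preimage
      (LinearMap.mulRight 𝕜 y)) (fun p hp => subset_diskedHull _ (mul_mem_mul hp hy)) hx
  rintro _ ⟨x, hx, y, hy, rfl⟩
  exact diskedHull_subset ((isDisk_diskedHull (𝕜 := 𝕜) (P * Q)).preimage
    (LinearMap.mulLeft 𝕜 x)) (fun q hq => hl x hx q hq) hy

end DiskMaps

namespace BoundedDisk

section NormedSpaces

variable {𝕜 : Type uK} {V : Type uV} {W : Type uW} [RCLike 𝕜]
  [AddCommGroup V] [Module 𝕜 V] [Bornology V] [SeparatedConvexBornologicalSpace 𝕜 V]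
  [AddCommGroup W] [Module 𝕜 W] [Bornology W] [SeparatedConvexBornologicalSpace 𝕜 W]

omit [SeparatedConvexBornologicalSpace 𝕜 V] in
theorem norm_le_one_iff (T : BoundedDisk 𝕜 V) (x : T.Space) : ‖x‖ ≤ 1 ↔ T.val x ∈ T.carrier := by
  simpa using T.norm_le_iff x one_pos

theorem val_mem_smul_of_norm_le (T : BoundedDisk 𝕜 V) {x : T.Space} {r : ℝ} (h : ‖x‖ ≤ r) :
    T.val x ∈ (r : 𝕜) • T.carrier := by
  rcases ((norm_nonneg x).trans h).eq_or_lt with hr | hr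
  · have : ‖x‖ = r := le_antisymm h (hr ▸ norm_nonneg x)
    exact this ▸ T.val_mem_smul_norm x
  · exact (T.norm_le_iff x hr).1 h

theorem exists_val_eq_of_mem_smul (T : BoundedDisk 𝕜 V) {v : V} {r : ℝ}
    (h : v ∈ (r : 𝕜) • T.carrier) : ∃ y : T.Space, T.val y = v ∧ ‖y‖ ≤ |r| := by
  obtain ⟨w, hw, rfl⟩ := h
  refine ⟨(r : 𝕜) • T.ofMem w hw, by rw [map_smul, val_ofMem], ?_⟩
  rw [norm_smul, RCLike.norm_ofReal]
  exact mul_le_of_le_one_right (abs_nonneg r) ((T.norm_le_one_iff _).2 hw)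

omit [SeparatedConvexBornologicalSpace 𝕜 V] in
theorem exists_val_eq_of_mem (T : BoundedDisk 𝕜 V) {v : V} (h : v ∈ T.carrier) :
    ∃ y : T.Space, T.val y = v ∧ ‖y‖ ≤ 1 :=
  ⟨T.ofMem v h, rfl, (T.norm_le_one_iff _).2 h⟩

theorem isBounded_smul_carrier (T : BoundedDisk 𝕜 V) (c : 𝕜) : IsBounded (c • T.carrier) :=
  SeparatedConvexBornologicalSpace.isBounded_smul c T.isBounded

theorem isBounded_val_image (T : BoundedDisk 𝕜 V) {s : Set T.Space} (hs : IsBounded s) :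
    IsBounded (T.val '' s) := by
  obtain ⟨r, hr⟩ := hs.exists_norm_le
  refine (T.isBounded_smul_carrier (r : 𝕜)).subset ?_
  rintro _ ⟨x, hx, rfl⟩
  exact T.val_mem_smul_of_norm_le (hr x hx)

/-- Some bounded disk contains any two given ones. -/
theorem exists_superset₂ (T₁ T₂ : BoundedDisk 𝕜 V) :
    ∃ T : BoundedDisk 𝕜 V, T₁.carrier ⊆ T.carrier ∧ T₂.carrier ⊆ T.carrier := by
  obtain ⟨T, hT⟩ := exists_superset (𝕜 := 𝕜) (T₁.isBounded.union T₂.isBounded)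
  exact ⟨T, subset_union_left.trans hT, subset_union_right.trans hT⟩

theorem norm_inclusion_le {S T : BoundedDisk 𝕜 V} (h : S.carrier ⊆ T.carrier) (x : S.Space) :
    ‖inclusion h x‖ ≤ ‖x‖ := by
  refine T.norm_le_of_val_mem _ (norm_nonneg x) ?_
  exact smul_set_mono h (S.val_mem_smul_norm x)

/-- A linear map from a normed space to `W` that maps the unit ball into the bounded disk `T`
is a contraction into `W_T`. -/
noncomputable def codRestrict {X : Type*} [NormedAddCommGroup X] [NormedSpace 𝕜 X]
    (φ : X →ₗ[𝕜] W) (T : BoundedDisk 𝕜 W) (h : ∀ x, φ x ∈ ((‖x‖ : ℝ) : 𝕜) • T.carrier) :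
    X →L[𝕜] T.Space :=
  LinearMap.mkContinuous
    (LinearMap.codRestrict (Submodule.span 𝕜 T.carrier) φ fun x => by
      obtain ⟨y, hy, hxy⟩ := h x
      rw [← hxy]
      exact Submodule.smul_mem _ _ (Submodule.subset_span hy) : X →ₗ[𝕜] T.Space) 1 (by
    intro x
    rw [one_mul]
    exact T.norm_le_of_val_mem _ (norm_nonneg x) (h x))

@[simp] theorem val_codRestrict {X : Type*} [NormedAddCommGroup X] [NormedSpace 𝕜 X]
    (φ : X →ₗ[𝕜] W) (T : BoundedDisk 𝕜 W) (h : ∀ x, φ x ∈ ((‖x‖ : ℝ) : 𝕜) • T.carrier) (x : X) :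
    T.val (codRestrict φ T h x) = φ x := rfl

theorem norm_codRestrict_le {X : Type*} [NormedAddCommGroup X] [NormedSpace 𝕜 X]
    (φ : X →ₗ[𝕜] W) (T : BoundedDisk 𝕜 W) (h : ∀ x, φ x ∈ ((‖x‖ : ℝ) : 𝕜) • T.carrier) :
    ‖codRestrict φ T h‖ ≤ 1 :=
  LinearMap.mkContinuous_norm_le _ zero_le_one _

end NormedSpaces

section LinearMaps

variable {𝕜 : Type uK} {V : Type uV} {W : Type uW} [RCLike 𝕜]
  [AddCommGroup V] [Module 𝕜 V] [Bornology V] [SeparatedConvexBornologicalSpace 𝕜 V]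
  [AddCommGroup W] [Module 𝕜 W]

/-- A linear map out of `V_T` is homogeneous with respect to the disk `T`: it is controlled by its
values on `T`. -/
theorem map_mem_smul_of_forall_mem (T : BoundedDisk 𝕜 V) (φ : T.Space →ₗ[𝕜] W) {P : Set W}
    (h : ∀ x : T.Space, T.val x ∈ T.carrier → φ x ∈ P) (x : T.Space) :
    φ x ∈ ((‖x‖ : ℝ) : 𝕜) • P := by
  obtain ⟨y, hy, hxy⟩ := T.val_mem_smul_norm x
  refine ⟨φ (T.ofMem y hy), h _ hy, ?_⟩
  change ((‖x‖ : ℝ) : 𝕜) • φ (T.ofMem y hy) = φ x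
  rw [← map_smul]
  congr 1
  apply T.val_injective
  rw [← hxy, map_smul, val_ofMem]

theorem isBounded_image_carrier (T : BoundedDisk 𝕜 V) {X : Type*} [Bornology X] {g : T.Space → X}
    (hg : IsBoundedMap g) : IsBounded (g '' {x | T.val x ∈ T.carrier}) := by
  refine hg _ ((Metric.isBounded_closedBall (x := (0 : T.Space)) (r := 1)).subset fun x hx => ?_)
  simpa using (T.norm_le_one_iff x).2 hx

end LinearMaps

section Products

variable {𝕜 : Type uK} {A : Type uA} [RCLike 𝕜]
  [NonUnitalRing A] [Module 𝕜 A] [IsScalarTower 𝕜 A A] [SMulCommClass 𝕜 A A] [Bornology A]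
  [SeparatedConvexBornologicalAlgebra 𝕜 A]

theorem mul_mem_smul {T₁ T₂ T₃ : BoundedDisk 𝕜 A} (h : T₁.carrier * T₂.carrier ⊆ T₃.carrier)
    (x : T₁.Space) (y : T₂.Space) :
    T₁.val x * T₂.val y ∈ ((‖x‖ * ‖y‖ : ℝ) : 𝕜) • T₃.carrier := by
  obtain ⟨x', hx', hx⟩ := T₁.val_mem_smul_norm x
  obtain ⟨y', hy', hy⟩ := T₂.val_mem_smul_norm y
  refine ⟨x' * y', h (mul_mem_mul hx' hy'), ?_⟩
  rw [← hx, ← hy]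
  simp only [smul_mul_smul_comm, RCLike.ofReal_mul]

/-- Multiplication as a bilinear contraction `A_{T₁} × A_{T₂} → A_{T₃}` if `T₁ · T₂ ⊆ T₃`. -/
noncomputable def mulL {T₁ T₂ T₃ : BoundedDisk 𝕜 A} (h : T₁.carrier * T₂.carrier ⊆ T₃.carrier) :
    T₁.Space →L[ℝ] T₂.Space →L[ℝ] T₃.Space :=
  have hspan : ∀ (x : T₁.Space) (y : T₂.Space),
      T₁.val x * T₂.val y ∈ Submodule.span 𝕜 T₃.carrier := fun x y => by
    obtain ⟨z, hz, hxy⟩ := mul_mem_smul h x y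
    rw [← hxy]
    exact Submodule.smul_mem _ _ (Submodule.subset_span hz)
  let m : T₁.Space → T₂.Space → T₃.Space := fun x y => ⟨T₁.val x * T₂.val y, hspan x y⟩
  have hm : ∀ x y, T₃.val (m x y) = T₁.val x * T₂.val y := fun _ _ => rfl
  LinearMap.mkContinuous₂ (LinearMap.mk₂ ℝ m
    (fun x y z => T₃.val_injective (by simp only [hm, map_add, add_mul]))
    (fun c x y => T₃.val_injective (by
      rw [T₃.real_smul_def, T₁.real_smul_def]
      simp only [hm, map_smul, smul_mul_assoc]))
    (fun x y z => T₃.val_injective (by simp only [hm, map_add, mul_add]))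
    (fun c x y => T₃.val_injective (by
      rw [T₃.real_smul_def, T₂.real_smul_def]
      simp only [hm, map_smul, mul_smul_comm]))) 1 (fun x y => by
    rw [one_mul]
    exact T₃.norm_le_of_val_mem _ (by positivity) (mul_mem_smul h x y))

@[simp] theorem val_mulL {T₁ T₂ T₃ : BoundedDisk 𝕜 A}
    (h : T₁.carrier * T₂.carrier ⊆ T₃.carrier) (x : T₁.Space) (y : T₂.Space) :
    T₃.val (mulL h x y) = T₁.val x * T₂.val y := rfl

theorem norm_mulL_le {T₁ T₂ T₃ : BoundedDisk 𝕜 A}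
    (h : T₁.carrier * T₂.carrier ⊆ T₃.carrier) : ‖mulL h‖ ≤ 1 :=
  ContinuousLinearMap.opNorm_le_bound₂ _ zero_le_one fun x y => by
    rw [one_mul]
    exact T₃.norm_le_of_val_mem _ (by positivity) (mul_mem_smul h x y)

end Products

end BoundedDisk

/-! ### Semicontinuity of the spectral radius -/

section Semicontinuity

theorem bornSpectralRadius_lt_one_iff {𝕜 : Type uK} {A : Type uA} [RCLike 𝕜] [NonUnitalRing A]
    [Module 𝕜 A] [Bornology A] {S : Set A} :
    bornSpectralRadius 𝕜 S < 1 ↔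
      ∃ r : ℝ, 0 < r ∧ r < 1 ∧ IsBounded (Subsemigroup.closure ((r : 𝕜)⁻¹ • S) : Set A) := by
  simp only [bornSpectralRadius, iInf_lt_iff, ENNReal.ofReal_lt_one]
  constructor
  · rintro ⟨r, h0, hb, h1⟩
    exact ⟨r, h0, h1, hb⟩
  · rintro ⟨r, h0, h1, hb⟩
    exact ⟨r, h0, hb, h1⟩

variable {𝕜 : Type uK} {A : Type uA} [RCLike 𝕜]
  [NonUnitalRing A] [Module 𝕜 A] [IsScalarTower 𝕜 A A] [SMulCommClass 𝕜 A A] [Bornology A]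
  [SeparatedConvexBornologicalAlgebra 𝕜 A]

/-- In a locally multiplicative algebra, the generators of a bounded multiplicative semigroup can be
enlarged by a small multiple of any bounded set: between consecutive factors from `δY` there are
only elements of the given semigroup `W`, and `δ(Y ∪ YW)` generates a bounded semigroup. -/
theorem IsLocallyMultiplicative.exists_isBounded_closure_union (hA : IsLocallyMultiplicative 𝕜 A)
    {X Y : Set A} (hX : IsBounded (Subsemigroup.closure X : Set A)) (hY : IsBounded Y) :
    ∃ δ : ℝ, 0 < δ ∧ IsBounded (Subsemigroup.closure (X ∪ (δ : 𝕜) • Y) : Set A) := by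
  set W := Subsemigroup.closure X with hW
  have hmul : ∀ {S T : Set A}, IsBounded S → IsBounded T → IsBounded (S * T) :=
    fun hS hT => SeparatedConvexBornologicalAlgebra.isBounded_mul (𝕜 := 𝕜) hS hT
  have hZ := hA (Y ∪ Y * W) (hY.union (hmul hY hX))
  simp only [bornSpectralRadius, iInf_lt_iff] at hZ
  obtain ⟨s, hs, hP, -⟩ := hZ
  set P := Subsemigroup.closure ((s : 𝕜)⁻¹ • (Y ∪ Y * W)) with hPdef
  refine ⟨s⁻¹, inv_pos.2 hs, ?_⟩
  have hPW : ∀ p ∈ P, ∀ w ∈ W, p * w ∈ P := by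
    intro p hp w hw
    induction hp using Subsemigroup.closure_induction with
    | mem z hz =>
      obtain ⟨z, hz, rfl⟩ := hz
      apply Subsemigroup.subset_closure
      refine ⟨z * w, ?_, (smul_mul_assoc _ _ _).symm⟩
      rcases hz with hz | ⟨y, hy, v, hv, rfl⟩
      · exact Or.inr (mul_mem_mul hz hw)
      · exact Or.inr ⟨y, hy, v * w, W.mul_mem hv hw, (mul_assoc _ _ _).symm⟩
    | mul p q _ _ _ hq => rw [mul_assoc]; exact P.mul_mem ‹_› hq
  have hPN : ∀ p ∈ P, ∀ x ∈ (W ∪ P ∪ W * P : Set A), p * x ∈ P := by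
    rintro p hp x ((hx | hx) | ⟨w, hw, q, hq, rfl⟩)
    · exact hPW p hp x hx
    · exact P.mul_mem hp hx
    · rw [← mul_assoc]
      exact P.mul_mem (hPW p hp w hw) hq
  refine ((hX.union hP).union (hmul hX hP)).subset ?_
  intro x hx
  induction hx using Subsemigroup.closure_induction with
  | mem x hx =>
    rcases hx with hx | ⟨y, hy, rfl⟩
    · exact Or.inl (Or.inl (Subsemigroup.subset_closure hx))
    · refine Or.inl (Or.inr (Subsemigroup.subset_closure ⟨y, Or.inl hy, ?_⟩))
      simp
  | mul x y _ _ hx hy =>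
    rcases hx with (hx | hx) | ⟨w, hw, p, hp, rfl⟩
    · rcases hy with (hy | hy) | ⟨w, hw, p, hp, rfl⟩
      · exact Or.inl (Or.inl (W.mul_mem hx hy))
      · exact Or.inr (mul_mem_mul hx hy)
      · exact Or.inr ⟨x * w, W.mul_mem hx hw, p, hp, mul_assoc _ _ _⟩
    · exact Or.inl (Or.inr (hPN x hx y hy))
    · exact Or.inr ⟨w, hw, p * y, hPN p hp y hy, (mul_assoc _ _ _).symm⟩

/-- If `ρ(X) < 1`, then `X` consists of elements of norm less than one in a normed algebra `A_T`
given by a multiplicative bounded disk `T`, which may be taken to absorb any bounded set `Y`. -/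
theorem IsLocallyMultiplicative.exists_multiplicative_disk (hA : IsLocallyMultiplicative 𝕜 A)
    {X Y : Set A} (hX : bornSpectralRadius 𝕜 X < 1) (hY : IsBounded Y) :
    ∃ (T : BoundedDisk 𝕜 A) (r δ : ℝ), T.carrier * T.carrier ⊆ T.carrier ∧ 0 < r ∧ r < 1 ∧ 0 < δ ∧
      X ⊆ (r : 𝕜) • T.carrier ∧ (δ : 𝕜) • Y ⊆ T.carrier := by
  obtain ⟨r, hr0, hr1, hb⟩ := bornSpectralRadius_lt_one_iff.1 hX
  obtain ⟨δ, hδ, hQ⟩ := hA.exists_isBounded_closure_union hb hY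
  have hr : (r : 𝕜) ≠ 0 := by exact_mod_cast hr0.ne'
  obtain ⟨P, hP⟩ := BoundedDisk.exists_superset (𝕜 := 𝕜) hQ
  refine ⟨⟨_, isDisk_diskedHull _, P.isBounded.subset (diskedHull_subset P.isDisk hP)⟩, r, δ,
    ?_, hr0, hr1, hδ, ?_, ?_⟩
  · refine (diskedHull_mul_subset _ _).trans (diskedHull_subset (isDisk_diskedHull _) ?_)
    rintro _ ⟨x, hx, y, hy, rfl⟩
    exact subset_diskedHull _ (Subsemigroup.mul_mem _ hx hy)
  · intro x hx
    rw [mem_smul_set_iff_inv_smul_mem₀ hr]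
    exact subset_diskedHull _ (Subsemigroup.subset_closure (Or.inl (smul_mem_smul_set hx)))
  · intro y hy
    exact subset_diskedHull _ (Subsemigroup.subset_closure (Or.inr hy))

omit [IsScalarTower 𝕜 A A] [SMulCommClass 𝕜 A A] [SeparatedConvexBornologicalAlgebra 𝕜 A] in
theorem bornSpectralRadius_lt_one_of_subset_smul {T : BoundedDisk 𝕜 A}
    (hT : T.carrier * T.carrier ⊆ T.carrier) {X : Set A} {r : ℝ} (h0 : 0 < r) (h1 : r < 1)
    (hX : X ⊆ (r : 𝕜) • T.carrier) : bornSpectralRadius 𝕜 X < 1 := by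
  have hr : (r : 𝕜) ≠ 0 := by exact_mod_cast h0.ne'
  refine bornSpectralRadius_lt_one_iff.2 ⟨r, h0, h1, T.isBounded.subset ?_⟩
  let P : Subsemigroup A := ⟨T.carrier, fun hx hy => hT (mul_mem_mul hx hy)⟩
  refine (Subsemigroup.closure_le (S := P)).2 ?_
  rintro _ ⟨x, hx, rfl⟩
  exact (mem_smul_set_iff_inv_smul_mem₀ hr _ _).1 (hX hx)

end Semicontinuity

/-! ### Estimates for the derivatives of smooth paths -/

section PathEstimates

variable {𝕜 : Type uK} {V : Type uV} {W : Type uW} [RCLike 𝕜]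
  [AddCommGroup V] [Module 𝕜 V] [Bornology V] [SeparatedConvexBornologicalSpace 𝕜 V]
  [AddCommGroup W] [Module 𝕜 W] [Bornology W] [SeparatedConvexBornologicalSpace 𝕜 W]

/-- The path `p` is smooth on all of `[0,1]` as a map to `V_T`, and `N k` bounds the norm of its
`k`-th derivative at the points of `K`. -/
def HasSmoothBoundOn (T : BoundedDisk 𝕜 V) (K : Set ℝ) (N : ℕ → ℝ) (p : I → V) : Prop :=
  ∃ g : ℝ → T.Space, IsSmoothLift T p g ∧
    ∀ k : ℕ, ∀ t ∈ K, ‖iteratedDerivWithin k g (Icc 0 1) t‖ ≤ N k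

theorem isBoundedPathSet_iff {F : Set (I → V)} :
    IsBoundedPathSet 𝕜 F ↔
      ∃ (T : BoundedDisk 𝕜 V) (N : ℕ → ℝ), ∀ p ∈ F, HasSmoothBoundOn T (Icc 0 1) N p :=
  Iff.rfl

theorem HasSmoothBoundOn.mono {T : BoundedDisk 𝕜 V} {K K' : Set ℝ} {N N' : ℕ → ℝ} {p : I → V}
    (h : HasSmoothBoundOn T K N p) (hK : K' ⊆ K) (hN : ∀ k, N k ≤ N' k) :
    HasSmoothBoundOn T K' N' p := by
  obtain ⟨g, hg, hb⟩ := h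
  exact ⟨g, hg, fun k t ht => (hb k t (hK ht)).trans (hN k)⟩

theorem HasSmoothBoundOn.isSmoothPath {T : BoundedDisk 𝕜 V} {K : Set ℝ} {N : ℕ → ℝ} {p : I → V}
    (h : HasSmoothBoundOn T K N p) : IsSmoothPath 𝕜 p := by
  obtain ⟨g, hg, -⟩ := h
  exact ⟨T, g, hg⟩

theorem HasSmoothBoundOn.exists_val_eq {T : BoundedDisk 𝕜 V} {K : Set ℝ} {N : ℕ → ℝ} {p : I → V}
    (h : HasSmoothBoundOn T K N p) (t : I) (ht : (t : ℝ) ∈ K) :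
    ∃ y : T.Space, T.val y = p t ∧ ‖y‖ ≤ N 0 := by
  obtain ⟨g, hg, hb⟩ := h
  exact ⟨g t, hg.2 t, by simpa using hb 0 t ht⟩

theorem HasSmoothBoundOn.union {T : BoundedDisk 𝕜 V} {K K' : Set ℝ} {N N' : ℕ → ℝ} {p : I → V}
    (h : HasSmoothBoundOn T K N p) (h' : HasSmoothBoundOn T K' N' p) (hK' : K' ⊆ Icc 0 1) :
    HasSmoothBoundOn T (K ∪ K') (fun k => max (N k) (N' k)) p := by
  obtain ⟨g, hg, hb⟩ := h
  obtain ⟨g', hg', hb'⟩ := h'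
  have heq : EqOn g g' (Icc 0 1) := fun t ht =>
    T.val_injective ((hg.2 ⟨t, ht⟩).trans (hg'.2 ⟨t, ht⟩).symm)
  refine ⟨g, hg, fun k t ht => ?_⟩
  rcases ht with ht | ht
  · exact (hb k t ht).trans (le_max_left _ _)
  · rw [iteratedDerivWithin_congr heq (hK' ht)]
    exact (hb' k t ht).trans (le_max_right _ _)

theorem HasSmoothBoundOn.continuousLinearMap_comp {T : BoundedDisk 𝕜 V} {T' : BoundedDisk 𝕜 W}
    {K : Set ℝ} {N : ℕ → ℝ} {p : I → V} {q : I → W} (h : HasSmoothBoundOn T K N p)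
    (hK : K ⊆ Icc 0 1) (L : T.Space →L[ℝ] T'.Space) {C : ℝ} (hC : ‖L‖ ≤ C)
    (hq : ∀ (t : I) (y : T.Space), T.val y = p t → T'.val (L y) = q t) :
    HasSmoothBoundOn T' K (fun k => C * N k) q := by
  obtain ⟨g, hg, hb⟩ := h
  refine ⟨fun t => L (g t), ⟨hg.1.continuousLinearMap_comp L, fun t => hq t _ (hg.2 t)⟩,
    fun k t ht => ?_⟩
  have hle : ‖iteratedDerivWithin k (fun t => L (g t)) (Icc 0 1) t‖ ≤
      ‖L‖ * ‖iteratedDerivWithin k g (Icc 0 1) t‖ := by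
    rw [← norm_iteratedFDerivWithin_eq_norm_iteratedDerivWithin,
      ← norm_iteratedFDerivWithin_eq_norm_iteratedDerivWithin]
    exact L.norm_iteratedFDerivWithin_comp_left (hg.1 t (hK ht)) (uniqueDiffOn_Icc zero_lt_one)
      (hK ht) (by exact_mod_cast le_top)
  exact hle.trans (mul_le_mul hC (hb k t ht) (norm_nonneg _) ((norm_nonneg _).trans hC))

theorem HasSmoothBoundOn.mono_disk {T T' : BoundedDisk 𝕜 V} {K : Set ℝ} {N : ℕ → ℝ} {p : I → V}
    (h : HasSmoothBoundOn T K N p) (hK : K ⊆ Icc 0 1) (hT : T.carrier ⊆ T'.carrier) :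
    HasSmoothBoundOn T' K N p := by
  have hL : ‖(BoundedDisk.inclusion hT).restrictScalars ℝ‖ ≤ 1 :=
    ContinuousLinearMap.opNorm_le_bound _ zero_le_one fun x => by
      rw [one_mul]
      exact BoundedDisk.norm_inclusion_le hT x
  refine (h.continuousLinearMap_comp (q := p) hK _ hL fun t y hy => ?_).mono subset_rfl
    fun k => (one_mul _).le
  exact hy

theorem HasSmoothBoundOn.smul {T : BoundedDisk 𝕜 V} {K : Set ℝ} {N : ℕ → ℝ} {p : I → V}
    (h : HasSmoothBoundOn T K N p) (hK : K ⊆ Icc 0 1) (c : 𝕜) :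
    HasSmoothBoundOn T K (fun k => ‖c‖ * N k) (c • p) := by
  have hL : ‖(c • ContinuousLinearMap.id 𝕜 T.Space).restrictScalars ℝ‖ ≤ ‖c‖ :=
    ContinuousLinearMap.opNorm_le_bound _ (norm_nonneg c) fun x => (norm_smul c x).le
  refine h.continuousLinearMap_comp hK _ hL fun t y hy => ?_
  change T.val (c • y) = c • p t
  rw [map_smul, hy]

theorem HasSmoothBoundOn.add {T : BoundedDisk 𝕜 V} {K : Set ℝ} {N N' : ℕ → ℝ} {p q : I → V}
    (hp : HasSmoothBoundOn T K N p) (hq : HasSmoothBoundOn T K N' q) (hK : K ⊆ Icc 0 1) :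
    HasSmoothBoundOn T K (fun k => N k + N' k) (p + q) := by
  obtain ⟨g, hg, hb⟩ := hp
  obtain ⟨g', hg', hb'⟩ := hq
  refine ⟨fun t => g t + g' t, ⟨hg.1.add hg'.1, fun t => by simp [hg.2, hg'.2]⟩,
    fun k t ht => ?_⟩
  rw [iteratedDerivWithin_fun_add (hK ht) (uniqueDiffOn_Icc zero_lt_one)
    ((hg.1 t (hK ht)).of_le (by exact_mod_cast le_top))
    ((hg'.1 t (hK ht)).of_le (by exact_mod_cast le_top))]
  exact (norm_add_le _ _).trans (add_le_add (hb k t ht) (hb' k t ht))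

theorem HasSmoothBoundOn.exists_val_eq_sub {T : BoundedDisk 𝕜 V} {N : ℕ → ℝ} {p : I → V}
    (h : HasSmoothBoundOn T (Icc 0 1) N p) (s t : I) :
    ∃ y : T.Space, T.val y = p t - p s ∧ ‖y‖ ≤ N 1 * |(t : ℝ) - s| := by
  obtain ⟨g, hg, hb⟩ := h
  refine ⟨g t - g s, by rw [map_sub, hg.2, hg.2], ?_⟩
  rw [← Real.norm_eq_abs]
  refine (convex_Icc (0 : ℝ) 1).norm_image_sub_le_of_norm_derivWithin_le
    (hg.1.differentiableOn (by simp)) (fun x hx => ?_) s.2 t.2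
  simpa [iteratedDerivWithin_one] using hb 1 x hx

theorem HasSmoothBoundOn.mul {A : Type uA} [NonUnitalRing A] [Module 𝕜 A] [IsScalarTower 𝕜 A A]
    [SMulCommClass 𝕜 A A] [Bornology A] [SeparatedConvexBornologicalAlgebra 𝕜 A]
    {T₁ T₂ T₃ : BoundedDisk 𝕜 A} (hT : T₁.carrier * T₂.carrier ⊆ T₃.carrier)
    {K : Set ℝ} {N N' : ℕ → ℝ} {p q : I → A}
    (hp : HasSmoothBoundOn T₁ K N p) (hq : HasSmoothBoundOn T₂ K N' q) (hK : K ⊆ Icc 0 1) :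
    HasSmoothBoundOn T₃ K
      (fun k => ∑ i ∈ Finset.range (k + 1), (k.choose i : ℝ) * N (k - i) * N' i) (p * q) := by
  obtain ⟨g, hg, hb⟩ := hp
  obtain ⟨g', hg', hb'⟩ := hq
  refine ⟨fun t => BoundedDisk.mulL hT (g t) (g' t), ⟨?_, fun t => by simp [hg.2, hg'.2]⟩,
    fun k t ht => ?_⟩
  · exact (BoundedDisk.mulL hT).isBoundedBilinearMap.contDiff.comp_contDiffOn
      (hg.1.prodMk hg'.1)
  have hle := (BoundedDisk.mulL hT).norm_iteratedFDerivWithin_le_of_bilinear_of_le_one (n := k)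
    hg.1 hg'.1 (uniqueDiffOn_Icc zero_lt_one) (hK ht) (by exact_mod_cast le_top)
    (BoundedDisk.norm_mulL_le hT)
  simp only [norm_iteratedFDerivWithin_eq_norm_iteratedDerivWithin] at hle
  beta_reduce
  rw [← Finset.sum_range_reflect]
  refine hle.trans (Finset.sum_le_sum fun i hi => ?_)
  have hik : i ≤ k := Nat.lt_succ_iff.1 (Finset.mem_range.1 hi)
  have h1 : k + 1 - 1 - i = k - i := by omega
  have h2 : k - (k - i) = i := by omega
  rw [h1, h2, Nat.choose_symm hik]
  have h3 := hb i t ht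
  have h4 := hb' (k - i) t ht
  have h5 := (norm_nonneg _).trans h3
  gcongr

/-- The paths `t ↦ φ(t) v` with fixed smooth `φ` and `v` in a bounded set have uniformly bounded
derivatives. -/
theorem exists_hasSmoothBoundOn_smul (T : BoundedDisk 𝕜 V) {φ : ℝ → ℝ} (hφ : ContDiff ℝ ∞ φ) :
    ∃ N : ℕ → ℝ, ∀ v ∈ T.carrier,
      HasSmoothBoundOn T (Icc 0 1) N (fun t : I => ((φ t : ℝ) : 𝕜) • v) := by
  have h : ∀ k : ℕ, ∃ C, ∀ t ∈ Icc (0 : ℝ) 1, ‖iteratedDerivWithin k φ (Icc 0 1) t‖ ≤ C :=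
    fun k => isCompact_Icc.exists_bound_of_continuousOn
      (hφ.contDiffOn.continuousOn_iteratedDerivWithin (by exact_mod_cast le_top)
        (uniqueDiffOn_Icc zero_lt_one))
  choose N hN using h
  refine ⟨N, fun v hv => ?_⟩
  obtain ⟨y, rfl, hy⟩ := T.exists_val_eq_of_mem hv
  set L : ℝ →L[ℝ] T.Space := (1 : ℝ →L[ℝ] ℝ).smulRight y with hL
  have hL1 : ‖L‖ ≤ 1 := by
    refine ContinuousLinearMap.opNorm_le_bound _ zero_le_one fun x => ?_
    rw [one_mul, hL, ContinuousLinearMap.smulRight_apply, norm_smul]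
    exact mul_le_of_le_one_right (norm_nonneg _) hy
  refine ⟨fun t => L (φ t), ⟨hφ.contDiffOn.continuousLinearMap_comp L, fun t => ?_⟩,
    fun k t ht => ?_⟩
  · change T.val (φ t • y) = _
    rw [T.real_smul_def, map_smul]
  have hle : ‖iteratedDerivWithin k (fun t => L (φ t)) (Icc 0 1) t‖ ≤
      ‖L‖ * ‖iteratedDerivWithin k φ (Icc 0 1) t‖ := by
    rw [← norm_iteratedFDerivWithin_eq_norm_iteratedDerivWithin,
      ← norm_iteratedFDerivWithin_eq_norm_iteratedDerivWithin]
    exact L.norm_iteratedFDerivWithin_comp_left (hφ.contDiffOn t ht)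
      (uniqueDiffOn_Icc zero_lt_one) ht (by exact_mod_cast le_top)
  exact (hle.trans (mul_le_of_le_one_left (norm_nonneg _) hL1)).trans (hN k t ht)

end PathEstimates

/-! ### The spectral radius of bounded sets of smooth paths -/

/-- The bounds `Λ k` on the `k`-th derivatives of arbitrary products of paths whose own `k`-th
derivatives are bounded by `N k`, where `N 0 < 1`. The recursion makes `Λ` at least `N`
(`le_leibnizMajorant`) and stable under the Leibniz rule (`leibnizMajorant_mul_le`). -/
noncomputable def leibnizMajorant (N : ℕ → ℝ) : ℕ → ℝ
  | k => N k + (∑ i : Fin k, (k.choose i : ℝ) * N (k - i) * leibnizMajorant N i) / (1 - N 0)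
decreasing_by exact i.2

theorem leibnizMajorant_eq (N : ℕ → ℝ) (k : ℕ) :
    leibnizMajorant N k = N k +
      (∑ i ∈ Finset.range k, (k.choose i : ℝ) * N (k - i) * leibnizMajorant N i) / (1 - N 0) := by
  rw [leibnizMajorant, Fin.sum_univ_eq_sum_range
    (fun i => (k.choose i : ℝ) * N (k - i) * leibnizMajorant N i)]

theorem le_leibnizMajorant {N : ℕ → ℝ} (hN : ∀ k, 0 ≤ N k) (h0 : N 0 < 1) (k : ℕ) :
    N k ≤ leibnizMajorant N k := by
  induction k using Nat.strong_induction_on with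
  | _ k ih =>
    rw [leibnizMajorant_eq, le_add_iff_nonneg_right]
    refine div_nonneg (Finset.sum_nonneg fun i hi => ?_) (by linarith)
    have := (hN i).trans (ih i (Finset.mem_range.1 hi))
    have := hN (k - i)
    positivity

theorem leibnizMajorant_mul_le {N : ℕ → ℝ} (hN : ∀ k, 0 ≤ N k) (h0 : N 0 < 1) (k : ℕ) :
    ∑ i ∈ Finset.range (k + 1), (k.choose i : ℝ) * N (k - i) * leibnizMajorant N i ≤
      leibnizMajorant N k := by
  have h1 : 0 < 1 - N 0 := by linarith
  have heq := leibnizMajorant_eq N k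
  rw [Finset.sum_range_succ, Nat.choose_self, Nat.sub_self]
  set D := ∑ i ∈ Finset.range k, (k.choose i : ℝ) * N (k - i) * leibnizMajorant N i
  have hmul : leibnizMajorant N k * (1 - N 0) = N k * (1 - N 0) + D := by
    rw [heq, add_mul, div_mul_cancel₀ _ h1.ne']
  have := mul_nonneg (hN k) h1.le
  push_cast
  linarith

section PathAlgebra

variable {𝕜 : Type uK} {A : Type uA} [RCLike 𝕜]
  [NonUnitalRing A] [Module 𝕜 A] [IsScalarTower 𝕜 A A] [SMulCommClass 𝕜 A A] [Bornology A]
  [SeparatedConvexBornologicalAlgebra 𝕜 A]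

namespace SmoothPath

theorem isBounded_iff_exists {F : Set (SmoothPath 𝕜 A)} :
    IsBounded F ↔
      ∃ (T : BoundedDisk 𝕜 A) (N : ℕ → ℝ), ∀ p ∈ F, HasSmoothBoundOn T (Icc 0 1) N p.toFun := by
  rw [isBounded_iff, isBoundedPathSet_iff]
  simp only [forall_mem_image]

/-- Evaluation at a point of the interval. -/
def eval (t : I) : SmoothPath 𝕜 A →ₙₐ[𝕜] A where
  toFun p := p.toFun t
  map_smul' _ _ := rfl
  map_zero' := rfl
  map_add' _ _ := rfl
  map_mul' _ _ := rfl

@[simp] theorem eval_apply (t : I) (p : SmoothPath 𝕜 A) : eval t p = p.toFun t := rfl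

theorem isBoundedMap_eval (t : I) : IsBoundedMap (eval t : SmoothPath 𝕜 A →ₙₐ[𝕜] A) := by
  intro F hF
  obtain ⟨T, N, h⟩ := isBounded_iff_exists.1 hF
  refine (T.isBounded_smul_carrier ((N 0 : ℝ) : 𝕜)).subset ?_
  rintro _ ⟨p, hp, rfl⟩
  obtain ⟨y, hy, hyN⟩ := (h p hp).exists_val_eq t t.2
  rw [eval_apply, ← hy]
  exact T.val_mem_smul_of_norm_le hyN

theorem isBounded_mul {F G : Set (SmoothPath 𝕜 A)} (hF : IsBounded F) (hG : IsBounded G) :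
    IsBounded (F * G) := by
  obtain ⟨T₁, N₁, h₁⟩ := isBounded_iff_exists.1 hF
  obtain ⟨T₂, N₂, h₂⟩ := isBounded_iff_exists.1 hG
  obtain ⟨T, hT⟩ := BoundedDisk.exists_superset (𝕜 := 𝕜)
    (SeparatedConvexBornologicalAlgebra.isBounded_mul (𝕜 := 𝕜) T₁.isBounded T₂.isBounded)
  refine isBounded_iff_exists.2
    ⟨T, fun k => ∑ i ∈ Finset.range (k + 1), (k.choose i : ℝ) * N₁ (k - i) * N₂ i, ?_⟩
  rintro _ ⟨p, hp, q, hq, rfl⟩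
  exact (h₁ p hp).mul hT (h₂ q hq) subset_rfl

theorem isBounded_smul_add_smul {F G : Set (SmoothPath 𝕜 A)} (hF : IsBounded F) (hG : IsBounded G)
    (a b : 𝕜) : IsBounded (a • F + b • G) := by
  obtain ⟨T₁, N₁, h₁⟩ := isBounded_iff_exists.1 hF
  obtain ⟨T₂, N₂, h₂⟩ := isBounded_iff_exists.1 hG
  obtain ⟨T, hT₁, hT₂⟩ := BoundedDisk.exists_superset₂ T₁ T₂
  refine isBounded_iff_exists.2 ⟨T, fun k => ‖a‖ * N₁ k + ‖b‖ * N₂ k, ?_⟩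
  rintro _ ⟨_, ⟨p, hp, rfl⟩, _, ⟨q, hq, rfl⟩, rfl⟩
  exact (((h₁ p hp).mono_disk subset_rfl hT₁).smul subset_rfl a).add
    (((h₂ q hq).mono_disk subset_rfl hT₂).smul subset_rfl b) subset_rfl

/-- Products of paths that take values of norm at most `N 0 < 1` on `K` in a normed algebra `A_T`
have uniformly bounded derivatives on `K`. -/
theorem exists_hasSmoothBoundOn_closure {T : BoundedDisk 𝕜 A}
    (hT : T.carrier * T.carrier ⊆ T.carrier) {K : Set ℝ} (hK : K ⊆ Icc 0 1) {N : ℕ → ℝ}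
    (hN : ∀ k, 0 ≤ N k) (h0 : N 0 < 1) {F : Set (SmoothPath 𝕜 A)}
    (hF : ∀ p ∈ F, HasSmoothBoundOn T K N p.toFun) :
    ∀ w ∈ Subsemigroup.closure F, HasSmoothBoundOn T K (leibnizMajorant N) w.toFun := by
  intro w hw
  -- Words of length one satisfy the estimate, and left multiplication by a letter preserves it.
  suffices h : HasSmoothBoundOn T K (leibnizMajorant N) w.toFun ∧
      ∀ p : SmoothPath 𝕜 A, HasSmoothBoundOn T K (leibnizMajorant N) p.toFun →
        HasSmoothBoundOn T K (leibnizMajorant N) (w * p).toFun from h.1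
  induction hw using Subsemigroup.closure_induction with
  | mem w hw =>
    exact ⟨(hF w hw).mono subset_rfl (le_leibnizMajorant hN h0), fun p hp =>
      ((hF w hw).mul hT hp hK).mono subset_rfl (leibnizMajorant_mul_le hN h0)⟩
  | mul v w _ _ hv hw =>
    refine ⟨hv.2 w hw.1, fun p hp => ?_⟩
    rw [mul_assoc]
    exact hv.2 _ (hw.2 p hp)

end SmoothPath

/-- Bounds on the values of a path replace the given bound on its zeroth derivative. -/
theorem HasSmoothBoundOn.update_zero {T : BoundedDisk 𝕜 A} {K : Set ℝ} {N : ℕ → ℝ} {p : I → A}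
    (h : HasSmoothBoundOn T K N p) (hK : K ⊆ Icc 0 1) {c : ℝ}
    (hc : ∀ t : I, (t : ℝ) ∈ K → ∃ y : T.Space, T.val y = p t ∧ ‖y‖ ≤ c) :
    HasSmoothBoundOn T K (Function.update N 0 c) p := by
  obtain ⟨g, hg, hb⟩ := h
  refine ⟨g, hg, fun k t ht => ?_⟩
  rcases k.eq_zero_or_pos with rfl | hk
  · obtain ⟨y, hy, hyc⟩ := hc ⟨t, hK ht⟩ ht
    have : g t = y := T.val_injective ((hg.2 ⟨t, hK ht⟩).trans hy.symm)
    simpa [this] using hyc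
  · rw [Function.update_of_ne hk.ne']
    exact hb k t ht

theorem HasSmoothBoundOn.of_smul_subset {T T' : BoundedDisk 𝕜 A} {K : Set ℝ} {N : ℕ → ℝ}
    {p : I → A} (h : HasSmoothBoundOn T K N p) (hK : K ⊆ Icc 0 1) {δ : ℝ} (hδ : 0 < δ)
    (hT : (δ : 𝕜) • T.carrier ⊆ T'.carrier) :
    HasSmoothBoundOn T' K (fun k => δ⁻¹ * N k) p := by
  have hδ' : (δ : 𝕜) ≠ 0 := by exact_mod_cast hδ.ne'
  have hmem : ∀ x : T.Space, ((δ : 𝕜) • T.val) x ∈ ((‖x‖ : ℝ) : 𝕜) • T'.carrier :=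
    T.map_mem_smul_of_forall_mem _ fun x hx => hT (smul_mem_smul_set hx)
  set L := BoundedDisk.codRestrict ((δ : 𝕜) • T.val) T' hmem with hLdef
  have hL : ‖L‖ ≤ 1 := BoundedDisk.norm_codRestrict_le _ _ _
  refine h.continuousLinearMap_comp hK (((δ : 𝕜)⁻¹ • L).restrictScalars ℝ) ?_ fun t y hy => ?_
  · refine ContinuousLinearMap.opNorm_le_bound _ (by positivity) fun x => ?_
    change ‖(δ : 𝕜)⁻¹ • L x‖ ≤ _
    rw [norm_smul, norm_inv, RCLike.norm_ofReal, abs_of_pos hδ]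
    gcongr
    exact L.le_of_opNorm_le hL x |>.trans (one_mul _).le
  · change T'.val ((δ : 𝕜)⁻¹ • L y) = p t
    rw [map_smul, hLdef, BoundedDisk.val_codRestrict, LinearMap.smul_apply, inv_smul_smul₀ hδ', hy]

/-- A bounded set of smooth paths in a locally multiplicative algebra has spectral radius less than
one if all its evaluations do. Near a given point, all paths in the set take values in a small ball
of a normed algebra `A_T`, and the derivatives of products are controlled by the Leibniz rule;
the interval is compact. -/
theorem IsLocallyMultiplicative.bornSpectralRadius_smoothPath_lt_one
    (hA : IsLocallyMultiplicative 𝕜 A) {F : Set (SmoothPath 𝕜 A)} (hF : IsBounded F)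
    (h : ∀ t : I, bornSpectralRadius 𝕜 ((fun p : SmoothPath 𝕜 A => p.toFun t) '' F) < 1) :
    bornSpectralRadius 𝕜 F < 1 := by
  obtain ⟨T₀, N₀, hT₀⟩ := SmoothPath.isBounded_iff_exists.1 hF
  let P : Set ℝ → Prop := fun K => ∀ᶠ R : ℝ in 𝓝[<] 1, ∃ (T : BoundedDisk 𝕜 A) (N : ℕ → ℝ),
    ∀ w ∈ Subsemigroup.closure ((R : 𝕜)⁻¹ • F), HasSmoothBoundOn T (K ∩ Icc 0 1) N w.toFun
  have hmono : ∀ ⦃K K' : Set ℝ⦄, K ⊆ K' → P K' → P K := by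
    intro K K' hK hP
    filter_upwards [hP] with R ⟨T, N, hw⟩
    exact ⟨T, N, fun w hw' => (hw w hw').mono (inter_subset_inter_left _ hK) fun _ => le_rfl⟩
  have hlocal : ∀ t₀ ∈ Icc (0 : ℝ) 1, ∃ K ∈ 𝓝[Icc 0 1] t₀, P K := by
    intro t₀ ht₀
    obtain ⟨T, r, δ, hT, hr0, hr1, hδ, hFr, hTδ⟩ :=
      hA.exists_multiplicative_disk (h ⟨t₀, ht₀⟩) T₀.isBounded
    have hFT : ∀ p ∈ F, HasSmoothBoundOn T (Icc 0 1) (fun k => δ⁻¹ * N₀ k) p.toFun :=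
      fun p hp => (hT₀ p hp).of_smul_subset subset_rfl hδ hTδ
    have hnhds : {t : ℝ | δ⁻¹ * N₀ 1 * |t - t₀| < (1 - r) / 2} ∈ 𝓝 t₀ := by
      refine (isOpen_lt (by fun_prop) continuous_const).mem_nhds ?_
      simp only [mem_ofPred_eq, sub_self, abs_zero, mul_zero]
      linarith
    refine ⟨_, mem_nhdsWithin_of_mem_nhds hnhds, ?_⟩
    set K := {t : ℝ | δ⁻¹ * N₀ 1 * |t - t₀| < (1 - r) / 2}
    filter_upwards [Ioo_mem_nhdsLT (show (1 + r) / 2 < 1 by linarith)] with R ⟨hR, hR1⟩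
    have hR0 : 0 < R := by linarith
    -- Absolute values ensure nonnegativity even if `F` is empty.
    refine ⟨T, _, SmoothPath.exists_hasSmoothBoundOn_closure (F := (R : 𝕜)⁻¹ • F)
      (N := Function.update (fun k => |R⁻¹ * (δ⁻¹ * N₀ k)|) 0 (R⁻¹ * ((1 + r) / 2)))
      hT inter_subset_right ?_ ?_ ?_⟩
    · intro k
      rcases k.eq_zero_or_pos with rfl | hk
      · rw [Function.update_self]
        positivity
      · rw [Function.update_of_ne hk.ne']
        exact abs_nonneg _
    · rw [Function.update_self, inv_mul_lt_iff₀ hR0]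
      linarith
    · rintro _ ⟨p, hp, rfl⟩
      have hRn : ‖(R : 𝕜)⁻¹‖ = R⁻¹ := by
        rw [norm_inv, RCLike.norm_ofReal, abs_of_pos hR0]
      have hp' := ((hFT p hp).smul subset_rfl (R : 𝕜)⁻¹).mono (K' := K ∩ Icc 0 1)
        inter_subset_right (fun k => le_abs_self _)
      rw [hRn] at hp'
      refine hp'.update_zero inter_subset_right fun t ht => ?_
      obtain ⟨y, hy, hyr⟩ := T.exists_val_eq_of_mem_smul (hFr (mem_image_of_mem _ hp))
      obtain ⟨z, hz, hzr⟩ := (hFT p hp).exists_val_eq_sub ⟨t₀, ht₀⟩ t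
      refine ⟨(R : 𝕜)⁻¹ • (y + z), ?_, ?_⟩
      · rw [map_smul, map_add, hy, hz]
        simp
      · rw [norm_smul, hRn]
        gcongr
        rw [abs_of_pos hr0] at hyr
        have := ht.1
        simp only [K, mem_ofPred_eq] at this
        have := norm_add_le y z
        linarith
  have hP : P (Icc 0 1) := by
    refine isCompact_Icc.induction_on ?_ hmono ?_ hlocal
    · obtain ⟨K, -, hK⟩ := hlocal 0 (by simp)
      exact hmono (empty_subset _) hK
    · intro K K' hK hK'
      filter_upwards [hK, hK'] with R ⟨T, N, hw⟩ ⟨T', N', hw'⟩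
      obtain ⟨T'', h₁, h₂⟩ := BoundedDisk.exists_superset₂ T T'
      refine ⟨T'', fun k => max (N k) (N' k), fun w hwF => ?_⟩
      rw [union_inter_distrib_right]
      exact ((hw w hwF).mono_disk inter_subset_right h₁).union
        ((hw' w hwF).mono_disk inter_subset_right h₂) inter_subset_right
  obtain ⟨R, ⟨T, N, hR⟩, hR0, hR1⟩ :=
    (hP.and (Ioo_mem_nhdsLT (show (0 : ℝ) < 1 from one_pos))).exists
  refine bornSpectralRadius_lt_one_iff.2 ⟨R, hR0, hR1, SmoothPath.isBounded_iff_exists.2 ⟨T, N, ?_⟩⟩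
  intro w hw
  simpa using hR w hw

end PathAlgebra

/-! ### Perturbation of approximately multiplicative maps -/

section Near

variable {𝕜 : Type uK} {V : Type uV} {W : Type uW} [RCLike 𝕜]
  [AddCommGroup V] [Module 𝕜 V] [Bornology V] [SeparatedConvexBornologicalSpace 𝕜 V]
  [AddCommGroup W] [Module 𝕜 W] [Bornology W] [SeparatedConvexBornologicalSpace 𝕜 W]

/-- The difference `u - v` maps the unit disk of `V_S` into `εT`. -/
def IsNear {S : BoundedDisk 𝕜 V} (T : BoundedDisk 𝕜 W) (ε : ℝ) (u v : S.Space →ₗ[𝕜] W) : Prop :=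
  ∀ x : S.Space, S.val x ∈ S.carrier → ∃ y : T.Space, T.val y = u x - v x ∧ ‖y‖ ≤ ε

variable {S : BoundedDisk 𝕜 V} {T T' : BoundedDisk 𝕜 W} {ε ε' : ℝ} {u v w : S.Space →ₗ[𝕜] W}

omit [SeparatedConvexBornologicalSpace 𝕜 V] in
theorem IsNear.mono (h : IsNear T ε u v) (hT : T.carrier ⊆ T'.carrier) (hε : ε ≤ ε') :
    IsNear T' ε' u v := by
  intro x hx
  obtain ⟨y, hy, hyε⟩ := h x hx
  exact ⟨BoundedDisk.inclusion hT y, hy, ((BoundedDisk.norm_inclusion_le hT y).trans hyε).trans hε⟩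

omit [SeparatedConvexBornologicalSpace 𝕜 V] in
theorem IsNear.self (u : S.Space →ₗ[𝕜] W) (hε : 0 ≤ ε) : IsNear T ε u u := fun x _ =>
  ⟨0, by simp, by simpa using hε⟩

omit [SeparatedConvexBornologicalSpace 𝕜 V] in
theorem IsNear.trans (h : IsNear T ε u v) (h' : IsNear T ε' v w) : IsNear T (ε + ε') u w := by
  intro x hx
  obtain ⟨y, hy, hyε⟩ := h x hx
  obtain ⟨z, hz, hzε⟩ := h' x hx
  exact ⟨y + z, by rw [map_add, hy, hz]; abel, (norm_add_le _ _).trans (add_le_add hyε hzε)⟩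

theorem IsNear.exists_val_eq (h : IsNear T ε u v) (x : S.Space) :
    ∃ y : T.Space, T.val y = u x - v x ∧ ‖y‖ ≤ ‖x‖ * ε := by
  obtain ⟨_, ⟨y, hyε, rfl⟩, hx⟩ := S.map_mem_smul_of_forall_mem (u - v)
    (P := T.val '' {y | ‖y‖ ≤ ε}) (fun x hx => by
      obtain ⟨y, hy, hyε⟩ := h x hx
      exact ⟨y, hyε, hy⟩) x
  refine ⟨((‖x‖ : ℝ) : 𝕜) • y, by rw [map_smul]; exact hx, ?_⟩
  rw [norm_smul, RCLike.norm_ofReal, abs_of_nonneg (norm_nonneg x)]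
  exact mul_le_mul_of_nonneg_left hyε (norm_nonneg x)

omit [SeparatedConvexBornologicalSpace 𝕜 V] in
/-- The set of maps near `v` is convex. -/
theorem IsNear.convex (h : IsNear T ε u v) (h' : IsNear T ε w v) {t : ℝ} (h0 : 0 ≤ t)
    (h1 : t ≤ 1) :
    IsNear T ε (((1 - t : ℝ) : 𝕜) • u + (t : 𝕜) • w) v := by
  intro x hx
  obtain ⟨y, hy, hyε⟩ := h x hx
  obtain ⟨z, hz, hzε⟩ := h' x hx
  refine ⟨((1 - t : ℝ) : 𝕜) • y + (t : 𝕜) • z, ?_, ?_⟩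
  · rw [map_add, map_smul, map_smul, hy, hz]
    simp only [LinearMap.add_apply, LinearMap.smul_apply, RCLike.ofReal_sub, RCLike.ofReal_one]
    module
  · refine (norm_add_le _ _).trans ?_
    rw [norm_smul, norm_smul, RCLike.norm_ofReal, RCLike.norm_ofReal, abs_of_nonneg h0,
      abs_of_nonneg (sub_nonneg.2 h1)]
    nlinarith

end Near

section Curvature

variable {𝕜 : Type uK} {D : Type uD} [RCLike 𝕜]
  [NonUnitalRing D] [Module 𝕜 D] [IsScalarTower 𝕜 D D] [SMulCommClass 𝕜 D D] [Bornology D]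
  [SeparatedConvexBornologicalAlgebra 𝕜 D] {S : BoundedDisk 𝕜 D}

theorem curvatureSet_comp {A : Type uA} {B : Type uB} [NonUnitalRing A] [Module 𝕜 A]
    [NonUnitalRing B] [Module 𝕜 B] (f : A →ₙₐ[𝕜] B) (g : S.two.Space →ₗ[𝕜] A) :
    curvatureSet S ((f : A →ₗ[𝕜] B) ∘ₗ g) = f '' curvatureSet S g := by
  ext b
  constructor
  · rintro ⟨x, y, hx, hy, rfl⟩
    exact ⟨_, ⟨x, y, hx, hy, rfl⟩, by simp⟩
  · rintro ⟨_, ⟨x, y, hx, hy, rfl⟩, rfl⟩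
    exact ⟨x, y, hx, hy, by simp⟩

theorem curvatureSet_subset {A : Type uA} [NonUnitalRing A] [Module 𝕜 A]
    (g : S.two.Space →ₗ[𝕜] A) :
    curvatureSet S g ⊆ (1 : 𝕜) • (g '' {x | S.two.val x ∈ S.two.carrier}) +
      (-1 : 𝕜) • (g '' {x | S.two.val x ∈ S.two.carrier} *
        g '' {x | S.two.val x ∈ S.two.carrier}) := by
  rintro _ ⟨x, y, hx, hy, rfl⟩
  have hmem : ∀ (z : D) (hz : z ∈ S.two.carrier),
      g (S.two.ofMem z hz) ∈ g '' {x | S.two.val x ∈ S.two.carrier} :=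
    fun z hz => ⟨_, hz, rfl⟩
  refine ⟨_, smul_mem_smul_set (hmem _ (BoundedDisk.mul_mem_two hx hy)), _,
    smul_mem_smul_set (mul_mem_mul (hmem x (BoundedDisk.mem_two hx))
      (hmem y (BoundedDisk.mem_two hy))), ?_⟩
  simp [sub_eq_add_neg]

variable {A : Type uA} {B : Type uB}
  [NonUnitalRing A] [Module 𝕜 A] [IsScalarTower 𝕜 A A] [SMulCommClass 𝕜 A A] [Bornology A]
  [SeparatedConvexBornologicalAlgebra 𝕜 A]
  [NonUnitalRing B] [Module 𝕜 B] [IsScalarTower 𝕜 B B] [SMulCommClass 𝕜 B B] [Bornology B]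
  [SeparatedConvexBornologicalAlgebra 𝕜 B]

theorem isBounded_curvatureSet {g : S.two.Space →ₗ[𝕜] A} (hg : IsBoundedMap g) :
    IsBounded (curvatureSet S g) := by
  have hF := S.two.isBounded_image_carrier hg
  exact (SeparatedConvexBornologicalSpace.isBounded_add (𝕜 := 𝕜)
    (SeparatedConvexBornologicalSpace.isBounded_smul _ hF)
    (SeparatedConvexBornologicalSpace.isBounded_smul _
      (SeparatedConvexBornologicalAlgebra.isBounded_mul (𝕜 := 𝕜) hF hF))).subset
    (curvatureSet_subset g)

theorem SmoothPath.isBounded_curvatureSet {g : S.two.Space →ₗ[𝕜] SmoothPath 𝕜 A}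
    (hg : IsBoundedMap g) : IsBounded (curvatureSet S g) := by
  have hF := S.two.isBounded_image_carrier hg
  exact (SmoothPath.isBounded_smul_add_smul hF (SmoothPath.isBounded_mul hF hF) _ _).subset
    (curvatureSet_subset g)

/-- Small perturbations of an approximately multiplicative map are approximately multiplicative. -/
theorem IsLocallyMultiplicative.exists_curvature_lt_one_of_isNear
    (hB : IsLocallyMultiplicative 𝕜 B) (h : ApproxMultMap S B) (T : BoundedDisk 𝕜 B) :
    ∃ ε : ℝ, 0 < ε ∧ ∀ k : S.two.Space →ₗ[𝕜] B, IsNear T ε k h.toLin →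
      bornSpectralRadius 𝕜 (curvatureSet S k) < 1 := by
  obtain ⟨P, hP⟩ := BoundedDisk.exists_superset (𝕜 := 𝕜)
    (T.isBounded.union (S.two.isBounded_image_carrier h.isBoundedMap))
  obtain ⟨Q, hQ⟩ := BoundedDisk.exists_superset (𝕜 := 𝕜) (P.isBounded.union
    (SeparatedConvexBornologicalAlgebra.isBounded_mul (𝕜 := 𝕜) P.isBounded P.isBounded))
  have hPQ : P.carrier ⊆ Q.carrier := subset_union_left.trans hQ
  have hPP : P.carrier * P.carrier ⊆ Q.carrier := subset_union_right.trans hQ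
  obtain ⟨T₁, r, δ, hT₁, hr0, hr1, hδ, hX, hY⟩ :=
    hB.exists_multiplicative_disk h.curvature_lt_one Q.isBounded
  have hδ' : (δ : 𝕜) ≠ 0 := by exact_mod_cast hδ.ne'
  -- The perturbation of the curvature has four terms, each of norm at most `ε`.
  refine ⟨min 1 (δ * (1 - r) / 8), lt_min one_pos (by
    have : 0 < 1 - r := by linarith
    positivity), fun k hk => ?_⟩
  set ε := min 1 (δ * (1 - r) / 8) with hε
  have hε1 : ε ≤ 1 := min_le_left _ _
  have hε2 : 4 * ε ≤ δ * (1 - r) / 2 := by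
    have : ε ≤ δ * (1 - r) / 8 := min_le_right _ _
    linarith
  refine bornSpectralRadius_lt_one_of_subset_smul (r := (1 + r) / 2) hT₁ (by linarith)
    (by linarith) ?_
  rintro _ ⟨x, y, hx, hy, rfl⟩
  have hk' := hk.mono (subset_union_left.trans hP) le_rfl
  set X := S.two.ofMem x (BoundedDisk.mem_two hx)
  set Y := S.two.ofMem y (BoundedDisk.mem_two hy)
  set XY := S.two.ofMem (x * y) (BoundedDisk.mul_mem_two hx hy)
  obtain ⟨ex, hex, hexε⟩ := hk' X (BoundedDisk.mem_two hx)
  obtain ⟨ey, hey, heyε⟩ := hk' Y (BoundedDisk.mem_two hy)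
  obtain ⟨exy, hexy, hexyε⟩ := hk' XY (BoundedDisk.mul_mem_two hx hy)
  obtain ⟨fx, hfx, hfx1⟩ := P.exists_val_eq_of_mem
    (hP (Or.inr (mem_image_of_mem h.toLin (show S.two.val X ∈ _ from BoundedDisk.mem_two hx))))
  obtain ⟨fy, hfy, hfy1⟩ := P.exists_val_eq_of_mem
    (hP (Or.inr (mem_image_of_mem h.toLin (show S.two.val Y ∈ _ from BoundedDisk.mem_two hy))))
  have hbil : ∀ a b : P.Space, ‖BoundedDisk.mulL hPP a b‖ ≤ ‖a‖ * ‖b‖ := fun a b => by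
    simpa using (BoundedDisk.mulL hPP).le_of_opNorm₂_le_of_le (BoundedDisk.norm_mulL_le hPP)
      le_rfl le_rfl
  set z : Q.Space := BoundedDisk.inclusion hPQ exy - BoundedDisk.mulL hPP ex fy -
    BoundedDisk.mulL hPP fx ey - BoundedDisk.mulL hPP ex ey with hz
  have hzε : ‖z‖ ≤ 4 * ε := by
    have hε0 : 0 ≤ ε := (norm_nonneg _).trans hexε
    have e1 := (BoundedDisk.norm_inclusion_le hPQ exy).trans hexyε
    have e2 := (hbil ex fy).trans (mul_le_mul hexε hfy1 (norm_nonneg _) hε0)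
    have e3 := (hbil fx ey).trans (mul_le_mul hfx1 heyε (norm_nonneg _) zero_le_one)
    have e4 := (hbil ex ey).trans (mul_le_mul hexε (heyε.trans hε1) (norm_nonneg _) hε0)
    have n1 := norm_sub_le (BoundedDisk.inclusion hPQ exy) (BoundedDisk.mulL hPP ex fy)
    have n2 := norm_sub_le (BoundedDisk.inclusion hPQ exy - BoundedDisk.mulL hPP ex fy)
      (BoundedDisk.mulL hPP fx ey)
    have n3 := norm_sub_le (BoundedDisk.inclusion hPQ exy - BoundedDisk.mulL hPP ex fy -
      BoundedDisk.mulL hPP fx ey) (BoundedDisk.mulL hPP ex ey)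
    linarith
  obtain ⟨c, hc, hcr⟩ := T₁.exists_val_eq_of_mem_smul
    (hX ⟨x, y, hx, hy, rfl⟩ : h.toLin XY - h.toLin X * h.toLin Y ∈ _)
  obtain ⟨d, hd, hdz⟩ := T₁.exists_val_eq_of_mem_smul
    (Q.map_mem_smul_of_forall_mem ((δ : 𝕜) • Q.val)
      (fun x hx => hY (smul_mem_smul_set hx)) z)
  have hval : k XY - k X * k Y = T₁.val (c + (δ : 𝕜)⁻¹ • d) := by
    rw [map_add, map_smul, hc, hd, LinearMap.smul_apply, inv_smul_smul₀ hδ', hz]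
    simp only [map_sub, BoundedDisk.val_inclusion, BoundedDisk.val_mulL, hex, hey, hexy, hfx, hfy,
      mul_sub, sub_mul]
    abel
  rw [hval]
  refine T₁.val_mem_smul_of_norm_le ((norm_add_le _ _).trans ?_)
  rw [norm_smul, norm_inv, RCLike.norm_ofReal, abs_of_pos hδ]
  rw [abs_of_pos hr0] at hcr
  rw [abs_of_nonneg (norm_nonneg _)] at hdz
  have : δ⁻¹ * ‖d‖ ≤ (1 - r) / 2 := by
    rw [inv_mul_le_iff₀ hδ]
    linarith
  linarith

/-- The linear map `x ↦ G(x)(t)`. -/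
def SmoothPath.evalComp {X : Type*} [AddCommGroup X] [Module 𝕜 X] (G : X →ₗ[𝕜] SmoothPath 𝕜 A)
    (t : I) : X →ₗ[𝕜] A :=
  (SmoothPath.eval (𝕜 := 𝕜) (A := A) t : SmoothPath 𝕜 A →ₗ[𝕜] A) ∘ₗ G

@[simp] theorem SmoothPath.evalComp_apply {X : Type*} [AddCommGroup X] [Module 𝕜 X]
    (G : X →ₗ[𝕜] SmoothPath 𝕜 A) (t : I) (x : X) : evalComp G t x = (G x).toFun t := rfl

/-- A bounded linear map into `E([0,1], A)` is approximately multiplicative if all its evaluations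
are. -/
theorem IsLocallyMultiplicative.curvature_smoothPath_lt_one (hA : IsLocallyMultiplicative 𝕜 A)
    {G : S.two.Space →ₗ[𝕜] SmoothPath 𝕜 A} (hG : IsBoundedMap G)
    (h : ∀ t : I, bornSpectralRadius 𝕜 (curvatureSet S (SmoothPath.evalComp G t)) < 1) :
    bornSpectralRadius 𝕜 (curvatureSet S G) < 1 := by
  refine hA.bornSpectralRadius_smoothPath_lt_one (SmoothPath.isBounded_curvatureSet hG)
    fun t => ?_
  have := h t
  rw [SmoothPath.evalComp, curvatureSet_comp] at this
  exact this

end Curvature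

/-! ### Linear homotopies and lifts of homotopies -/

section LinearHomotopy

variable {𝕜 : Type uK} {A : Type uA} {B : Type uB} [RCLike 𝕜]
  [NonUnitalRing A] [Module 𝕜 A] [IsScalarTower 𝕜 A A] [SMulCommClass 𝕜 A A] [Bornology A]
  [SeparatedConvexBornologicalAlgebra 𝕜 A]
  [NonUnitalRing B] [Module 𝕜 B] [IsScalarTower 𝕜 B B] [SMulCommClass 𝕜 B B] [Bornology B]
  [SeparatedConvexBornologicalAlgebra 𝕜 B]

namespace SmoothPath

/-- The path `t ↦ φ(t) a`, as a linear function of `a`. -/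
def scale {φ : ℝ → ℝ} (hφ : ContDiff ℝ ∞ φ) : A →ₗ[𝕜] SmoothPath 𝕜 A where
  toFun a := ⟨fun t => ((φ t : ℝ) : 𝕜) • a, by
    obtain ⟨T, hT⟩ := BoundedDisk.exists_superset (𝕜 := 𝕜) (isBounded_singleton (x := a))
    obtain ⟨N, hN⟩ := exists_hasSmoothBoundOn_smul T hφ
    exact (hN a (hT rfl)).isSmoothPath⟩
  map_add' a b := toFun_injective (funext fun t => smul_add _ a b)
  map_smul' c a := toFun_injective (funext fun t => smul_comm _ c a)

@[simp] theorem toFun_scale {φ : ℝ → ℝ} (hφ : ContDiff ℝ ∞ φ) (a : A) (t : I) :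
    (scale (𝕜 := 𝕜) hφ a).toFun t = ((φ t : ℝ) : 𝕜) • a := rfl

theorem isBoundedMap_scale {φ : ℝ → ℝ} (hφ : ContDiff ℝ ∞ φ) :
    IsBoundedMap (scale hφ : A →ₗ[𝕜] SmoothPath 𝕜 A) := by
  intro F hF
  obtain ⟨T, hT⟩ := BoundedDisk.exists_superset (𝕜 := 𝕜) hF
  obtain ⟨N, hN⟩ := exists_hasSmoothBoundOn_smul T hφ
  refine isBounded_iff_exists.2 ⟨T, N, ?_⟩
  rintro _ ⟨a, ha, rfl⟩
  exact hN a (hT ha)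

/-- The linear homotopy `t ↦ (1 - t) g + t g'`. -/
def linearHomotopy {X : Type*} [AddCommGroup X] [Module 𝕜 X] (g g' : X →ₗ[𝕜] A) :
    X →ₗ[𝕜] SmoothPath 𝕜 A :=
  scale (contDiff_const.sub contDiff_id : ContDiff ℝ ∞ fun t : ℝ => 1 - t) ∘ₗ g +
    scale (contDiff_id : ContDiff ℝ ∞ fun t : ℝ => t) ∘ₗ g'

theorem evalComp_linearHomotopy {X : Type*} [AddCommGroup X] [Module 𝕜 X] (g g' : X →ₗ[𝕜] A)
    (t : I) :
    evalComp (linearHomotopy g g') t = ((1 - t : ℝ) : 𝕜) • g + ((t : ℝ) : 𝕜) • g' := rfl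

theorem isBoundedMap_linearHomotopy {X : Type*} [AddCommGroup X] [Module 𝕜 X] [Bornology X]
    {g g' : X →ₗ[𝕜] A} (hg : IsBoundedMap g) (hg' : IsBoundedMap g') :
    IsBoundedMap (linearHomotopy g g') := by
  intro s hs
  refine (isBounded_smul_add_smul
    (isBoundedMap_scale (contDiff_const.sub contDiff_id : ContDiff ℝ ∞ fun t : ℝ => 1 - t) _
      (hg s hs))
    (isBoundedMap_scale (contDiff_id : ContDiff ℝ ∞ fun t : ℝ => t) _ (hg' s hs))
    (1 : 𝕜) (1 : 𝕜)).subset ?_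
  rintro _ ⟨x, hx, rfl⟩
  refine ⟨_, smul_mem_smul_set (mem_image_of_mem _ (mem_image_of_mem g hx)), _,
    smul_mem_smul_set (mem_image_of_mem _ (mem_image_of_mem g' hx)), ?_⟩
  simp only [one_smul]
  rfl

end SmoothPath

variable {D : Type uD}
  [NonUnitalRing D] [Module 𝕜 D] [IsScalarTower 𝕜 D D] [SMulCommClass 𝕜 D D] [Bornology D]
  [SeparatedConvexBornologicalAlgebra 𝕜 D] {S : BoundedDisk 𝕜 D}

/-- If `f` preserves spectral radii, then any two maps `g, g'` into `A` such that `f ∘ g` and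
`f ∘ g'` are sufficiently near a given approximately multiplicative map into `B` are connected by a
smooth homotopy of approximately multiplicative maps, namely the linear one. -/
theorem exists_linearHomotopy_of_isNear (hA : IsLocallyMultiplicative 𝕜 A)
    (hB : IsLocallyMultiplicative 𝕜 B) (f : A →ₙₐ[𝕜] B)
    (hρ : ∀ s : Set A, IsBounded s → bornSpectralRadius 𝕜 s = bornSpectralRadius 𝕜 (f '' s))
    (h : ApproxMultMap S B) (T : BoundedDisk 𝕜 B) :
    ∃ ε : ℝ, 0 < ε ∧ ∀ g g' : S.two.Space →ₗ[𝕜] A, IsBoundedMap g → IsBoundedMap g' →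
      IsNear T ε ((f : A →ₗ[𝕜] B) ∘ₗ g) h.toLin → IsNear T ε ((f : A →ₗ[𝕜] B) ∘ₗ g') h.toLin →
      ∃ G : ApproxMultMap S (SmoothPath 𝕜 A),
        (∀ x, (G.toLin x).toFun 0 = g x) ∧ ∀ x, (G.toLin x).toFun 1 = g' x := by
  obtain ⟨ε, hε, hk⟩ := hB.exists_curvature_lt_one_of_isNear h T
  refine ⟨ε, hε, fun g g' hg hg' hn hn' => ?_⟩
  refine ⟨⟨SmoothPath.linearHomotopy g g', SmoothPath.isBoundedMap_linearHomotopy hg hg',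
    hA.curvature_smoothPath_lt_one (SmoothPath.isBoundedMap_linearHomotopy hg hg') fun t => ?_⟩,
    fun x => ?_, fun x => ?_⟩
  · have hbdd : IsBoundedMap (SmoothPath.evalComp (SmoothPath.linearHomotopy g g') t) := by
      intro s hs
      have := SmoothPath.isBoundedMap_eval t _ (SmoothPath.isBoundedMap_linearHomotopy hg hg' s hs)
      rwa [image_image] at this
    rw [hρ _ (isBounded_curvatureSet hbdd), ← curvatureSet_comp]
    apply hk
    convert hn.convex hn' t.2.1 t.2.2 using 1
    rw [SmoothPath.evalComp_linearHomotopy]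
    ext x
    simp
  · have := LinearMap.congr_fun (SmoothPath.evalComp_linearHomotopy g g' 0) x
    simpa using this
  · have := LinearMap.congr_fun (SmoothPath.evalComp_linearHomotopy g g' 1) x
    simpa using this

/-- The nearness needed in `IsLocallyMultiplicative.exists_curvature_lt_one_of_isNear` can be chosen
uniformly along a smooth homotopy. -/
theorem IsLocallyMultiplicative.exists_curvature_lt_one_of_isNear_eval
    (hB : IsLocallyMultiplicative 𝕜 B) (H : ApproxMultMap S (SmoothPath 𝕜 B))
    (T : BoundedDisk 𝕜 B) :
    ∃ ε : ℝ, 0 < ε ∧ ∀ (t : I) (k : S.two.Space →ₗ[𝕜] B),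
      IsNear T ε k (SmoothPath.evalComp H.toLin t) →
      bornSpectralRadius 𝕜 (curvatureSet S k) < 1 := by
  obtain ⟨T₀, N, hN⟩ := SmoothPath.isBounded_iff_exists.1
    (S.two.isBounded_image_carrier H.isBoundedMap)
  obtain ⟨T', h₁, h₂⟩ := BoundedDisk.exists_superset₂ T T₀
  have key : ∀ᶠ ε : ℝ in 𝓝 0, ∀ t ∈ (univ : Set I), ∀ k : S.two.Space →ₗ[𝕜] B,
      IsNear T ε k (SmoothPath.evalComp H.toLin t) →
        bornSpectralRadius 𝕜 (curvatureSet S k) < 1 := by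
    refine isCompact_univ.eventually_forall_of_forall_eventually fun t₀ _ => ?_
    obtain ⟨ε₀, hε₀, hk⟩ := hB.exists_curvature_lt_one_of_isNear
      (H.map (SmoothPath.eval t₀) (SmoothPath.isBoundedMap_eval t₀)) T'
    have h1 : ∀ᶠ z : ℝ × I in 𝓝 (0, t₀), z.1 + N 1 * |(t₀ : ℝ) - z.2| < ε₀ := by
      refine ContinuousAt.eventually_lt (by fun_prop) continuousAt_const ?_
      simpa using hε₀
    filter_upwards [h1] with z hz k hkn
    refine hk k (IsNear.mono ((hkn.mono h₁ le_rfl).trans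
      (w := SmoothPath.evalComp H.toLin t₀) (ε' := N 1 * |(z.2 : ℝ) - t₀|) ?_) subset_rfl ?_)
    · intro x hx
      obtain ⟨y, hy, hyN⟩ := ((hN _ (mem_image_of_mem H.toLin hx)).mono_disk subset_rfl
        h₂).exists_val_eq_sub t₀ z.2
      exact ⟨y, hy, hyN⟩
    · rw [abs_sub_comm]
      exact hz.le
  obtain ⟨ε, hε, hε0⟩ := ((key.filter_mono nhdsWithin_le_nhds).and
    (self_mem_nhdsWithin : Ioi (0 : ℝ) ∈ 𝓝[>] 0)).exists
  exact ⟨ε, hε0, fun t => hε t (mem_univ t)⟩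

variable (𝕜) in
/-- For each bounded disk `S ⊆ B`, the inclusion `B_S → B` is a uniform limit on `S` of maps
`f ∘ τ` with bounded linear maps `τ : B_S → A`. -/
def HasApproximateLifts (f : A →ₙₐ[𝕜] B) : Prop :=
  ∀ S : BoundedDisk 𝕜 B, ∃ T : BoundedDisk 𝕜 B, ∀ ε : ℝ, 0 < ε →
    ∃ τ : S.Space →ₗ[𝕜] A, IsBoundedMap τ ∧ IsNear T ε ((f : A →ₗ[𝕜] B) ∘ₗ τ) S.val

/-- A bounded linear map into `E([0,1], B)` whose values on the unit disk are bounded in `B_T` can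
be composed with bounded linear maps out of `B_T`. -/
theorem SmoothPath.exists_comp {P : BoundedDisk 𝕜 D} {H : P.Space →ₗ[𝕜] SmoothPath 𝕜 B}
    {T : BoundedDisk 𝕜 B} {N : ℕ → ℝ}
    (hN : ∀ p ∈ H '' {x | P.val x ∈ P.carrier}, HasSmoothBoundOn T (Icc 0 1) N p.toFun)
    {τ : T.Space →ₗ[𝕜] A} (hτ : IsBoundedMap τ) :
    ∃ G : P.Space →ₗ[𝕜] SmoothPath 𝕜 A, IsBoundedMap G ∧
      ∀ (x : P.Space) (t : I) (y : T.Space), T.val y = (H x).toFun t → (G x).toFun t = τ y := by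
  have hH : ∀ x : P.Space, HasSmoothBoundOn T (Icc 0 1) (fun k => ‖x‖ * N k) (H x).toFun := by
    intro x
    obtain ⟨p, hp, hpx⟩ := P.map_mem_smul_of_forall_mem H
      (P := {p | HasSmoothBoundOn T (Icc 0 1) N p.toFun})
      (fun x hx => hN _ (mem_image_of_mem H hx)) x
    have := HasSmoothBoundOn.smul hp subset_rfl ((‖x‖ : ℝ) : 𝕜)
    rw [RCLike.norm_ofReal, abs_of_nonneg (norm_nonneg x)] at this
    rw [← hpx]
    exact this
  obtain ⟨Q, hQ⟩ := BoundedDisk.exists_superset (𝕜 := 𝕜) (T.isBounded_image_carrier hτ)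
  set L := BoundedDisk.codRestrict τ Q (T.map_mem_smul_of_forall_mem τ
    fun x hx => hQ (mem_image_of_mem τ hx)) with hL
  have hL1 : ‖L.restrictScalars ℝ‖ ≤ 1 :=
    ContinuousLinearMap.opNorm_le_bound _ zero_le_one fun x =>
      L.le_of_opNorm_le (BoundedDisk.norm_codRestrict_le _ _ _) x
  have hlift : ∀ (x : P.Space) (t : I), ∃ y : T.Space, T.val y = (H x).toFun t := fun x t => by
    obtain ⟨y, hy, -⟩ := (hH x).exists_val_eq t t.2
    exact ⟨y, hy⟩
  choose c hc using hlift
  have huniq : ∀ (x : P.Space) (t : I) (y : T.Space), T.val y = (H x).toFun t → c x t = y :=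
    fun x t y hy => T.val_injective ((hc x t).trans hy.symm)
  have hG : ∀ x : P.Space, HasSmoothBoundOn Q (Icc 0 1) (fun k => 1 * (‖x‖ * N k))
      (fun t => τ (c x t)) := fun x =>
    (hH x).continuousLinearMap_comp subset_rfl _ hL1 fun t y hy => by
      rw [huniq x t y hy]
      rfl
  refine ⟨{ toFun := fun x => ⟨fun t => τ (c x t), (hG x).isSmoothPath⟩,
            map_add' := fun x x' => toFun_injective (funext fun t => ?_),
            map_smul' := fun a x => toFun_injective (funext fun t => ?_) }, ?_, ?_⟩
  · change τ (c (x + x') t) = τ (c x t) + τ (c x' t)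
    rw [← map_add, huniq (x + x') t (c x t + c x' t)]
    rw [map_add, map_add, hc, hc]
    rfl
  · change τ (c (a • x) t) = a • τ (c x t)
    rw [← map_smul, huniq (a • x) t (a • c x t)]
    rw [map_smul, map_smul, hc]
    rfl
  · intro s hs
    obtain ⟨r, hr⟩ := hs.exists_norm_le
    refine isBounded_iff_exists.2 ⟨Q, fun k => r * |N k|, ?_⟩
    rintro _ ⟨x, hx, rfl⟩
    refine (hG x).mono subset_rfl fun k => ?_
    rw [one_mul]
    have := hr x hx
    have := norm_nonneg x
    have := le_abs_self (N k)
    have := abs_nonneg (N k)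
    calc ‖x‖ * N k ≤ ‖x‖ * |N k| := by gcongr
      _ ≤ r * |N k| := by gcongr
  · intro x t y hy
    change τ (c x t) = τ y
    rw [huniq x t y hy]

/-- A homotopy of approximately multiplicative maps into `B` can be approximated, uniformly in the
homotopy parameter, by homotopies of approximately multiplicative maps into `A`. -/
theorem HasApproximateLifts.exists_lift {f : A →ₙₐ[𝕜] B} (hf : HasApproximateLifts 𝕜 f)
    (hA : IsLocallyMultiplicative 𝕜 A) (hB : IsLocallyMultiplicative 𝕜 B)
    (hρ : ∀ s : Set A, IsBounded s → bornSpectralRadius 𝕜 s = bornSpectralRadius 𝕜 (f '' s))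
    (H : ApproxMultMap S (SmoothPath 𝕜 B)) :
    ∃ T : BoundedDisk 𝕜 B, ∀ ε : ℝ, 0 < ε → ∃ G : ApproxMultMap S (SmoothPath 𝕜 A),
      ∀ t : I, IsNear T ε ((f : A →ₗ[𝕜] B) ∘ₗ SmoothPath.evalComp G.toLin t)
        (SmoothPath.evalComp H.toLin t) := by
  obtain ⟨T₀, N, hN⟩ := SmoothPath.isBounded_iff_exists.1
    (S.two.isBounded_image_carrier H.isBoundedMap)
  obtain ⟨T, hT⟩ := hf T₀
  obtain ⟨ε₀, hε₀, hk⟩ := hB.exists_curvature_lt_one_of_isNear_eval H T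
  refine ⟨T, fun ε hε => ?_⟩
  have hm : 0 < min ε ε₀ := lt_min hε hε₀
  have hN0 : 0 < |N 0| + 1 := by positivity
  obtain ⟨τ, hτ, hnear⟩ := hT (min ε ε₀ / (|N 0| + 1)) (by positivity)
  obtain ⟨G, hG, hGτ⟩ := SmoothPath.exists_comp hN hτ
  have hGn : ∀ t : I, IsNear T (min ε ε₀) ((f : A →ₗ[𝕜] B) ∘ₗ SmoothPath.evalComp G t)
      (SmoothPath.evalComp H.toLin t) := by
    intro t x hx
    obtain ⟨y, hy, hyN⟩ := (hN _ (mem_image_of_mem H.toLin hx)).exists_val_eq t t.2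
    obtain ⟨z, hz, hzε⟩ := hnear.exists_val_eq y
    refine ⟨z, ?_, hzε.trans ?_⟩
    · rw [hz]
      simp [hGτ x t y hy, hy]
    · rw [mul_div_assoc', div_le_iff₀ hN0, mul_comm]
      have := le_abs_self (N 0)
      gcongr
      linarith
  refine ⟨⟨G, hG, hA.curvature_smoothPath_lt_one hG fun t => ?_⟩, fun t =>
    (hGn t).mono subset_rfl (min_le_left _ _)⟩
  have hbdd : IsBoundedMap (SmoothPath.evalComp G t) := by
    intro s hs
    have := SmoothPath.isBoundedMap_eval t _ (hG s hs)
    rwa [image_image] at this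
  rw [hρ _ (isBounded_curvatureSet hbdd), ← curvatureSet_comp]
  exact hk t _ ((hGn t).mono subset_rfl (min_le_right _ _))

end LinearHomotopy

/-! ### Approximate lifts from the local approximation property -/

section ApproximateLifts

/-- A relatively compact disk lies in a compact one: in a space `V_T` in which it is relatively
compact, its closure is again a disk. -/
theorem IsBornRelativelyCompact.exists_compact_disk {𝕜 : Type uK} {V : Type uV} [RCLike 𝕜]
    [AddCommGroup V] [Module 𝕜 V] [Bornology V] [SeparatedConvexBornologicalSpace 𝕜 V]
    (S : BoundedDisk 𝕜 V) (hS : IsBornRelativelyCompact 𝕜 S.carrier) :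
    ∃ P : BoundedDisk 𝕜 V, IsBornCompact 𝕜 P.carrier ∧ S.carrier ⊆ P.carrier := by
  obtain ⟨_, ⟨T, K, hK, rfl⟩, hSK⟩ := hS
  set C := closure (T.val ⁻¹' S.carrier) with hC
  have hCK : C ⊆ K := closure_minimal (fun x hx => by
    obtain ⟨y, hy, hyx⟩ := hSK hx
    rwa [← T.val_injective hyx]) hK.isClosed
  have hconv : ∀ x ∈ C, ∀ y ∈ C, ∀ a b : 𝕜, ‖a‖ + ‖b‖ ≤ 1 → a • x + b • y ∈ C := by
    intro x hx y hy a b hab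
    refine map_mem_closure₂ (f := fun x y : T.Space => a • x + b • y)
      ((continuous_fst.const_smul a).add (continuous_snd.const_smul b)) hx hy fun x hx y hy => ?_
    rw [mem_preimage, map_add, map_smul, map_smul]
    exact S.isDisk.absConvex _ hx _ hy a b hab
  have h0 : (0 : T.Space) ∈ C := subset_closure (by simpa using S.isDisk.zero_mem)
  have hscale : ∀ x ∈ C, ∀ t : ℝ, 1 < t → (t : 𝕜)⁻¹ • x ∈ C := by
    intro x hx t ht
    have := hconv x hx 0 h0 (t : 𝕜)⁻¹ 0 (by
      rw [norm_inv, RCLike.norm_ofReal, abs_of_pos (zero_lt_one.trans ht), norm_zero, add_zero]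
      exact inv_le_one_of_one_le₀ ht.le)
    simpa using this
  refine ⟨⟨T.val '' C, ⟨⟨0, h0, map_zero _⟩, ?_, ?_⟩,
    T.isBounded_val_image (hK.isBounded.subset hCK)⟩,
    ⟨T, C, hK.of_isClosed_subset isClosed_closure hCK, rfl⟩, fun x hx => ?_⟩
  · rintro _ ⟨x, hx, rfl⟩ _ ⟨y, hy, rfl⟩ a b hab
    exact ⟨_, hconv x hx y hy a b hab, by simp⟩
  · apply Subset.antisymm
    · rintro _ ⟨x, hx, rfl⟩
      simp only [mem_iInter, mem_Ioi]
      intro t ht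
      have ht0 : (t : 𝕜) ≠ 0 := by exact_mod_cast (zero_lt_one.trans ht).ne'
      rw [mem_smul_set_iff_inv_smul_mem₀ ht0, ← map_smul]
      exact mem_image_of_mem _ (hscale x hx t ht)
    · intro v hv
      simp only [mem_iInter, mem_Ioi] at hv
      obtain ⟨_, ⟨c, -, rfl⟩, hcv⟩ := hv 2 one_lt_two
      set y : T.Space := ((2 : ℝ) : 𝕜) • c with hy
      have hyv : T.val y = v := by rw [hy, map_smul]; exact hcv
      have hmem : ∀ t : ℝ, 1 < t → (t : 𝕜)⁻¹ • y ∈ C := by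
        intro t ht
        have ht0 : (t : 𝕜) ≠ 0 := by exact_mod_cast (zero_lt_one.trans ht).ne'
        have h := hv t ht
        rw [mem_smul_set_iff_inv_smul_mem₀ ht0, ← hyv, ← map_smul] at h
        obtain ⟨c', hc', hc'y⟩ := h
        rwa [← T.val_injective hc'y]
      refine ⟨y, ?_, hyv⟩
      have hlim : Tendsto (fun t : ℝ => (t : 𝕜)⁻¹ • y) (𝓝[>] 1) (𝓝 y) := by
        have h1 : ContinuousAt (fun t : ℝ => (t : 𝕜)⁻¹ • y) 1 :=
          (RCLike.continuous_ofReal.continuousAt.inv₀ (show ((1 : ℝ) : 𝕜) ≠ 0 by simp)).smul continuousAt_const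
        have h2 := h1.tendsto
        simp only [RCLike.ofReal_one, inv_one, one_smul] at h2
        exact h2.mono_left nhdsWithin_le_nhds
      exact isClosed_closure.mem_of_tendsto hlim
        (eventually_nhdsWithin_of_forall fun t ht => hmem t ht)
  · obtain ⟨y, -, rfl⟩ := hSK hx
    exact mem_image_of_mem _ (subset_closure hx)

variable {𝕜 : Type uK} {A : Type uA} {B : Type uB} [RCLike 𝕜]
  [NonUnitalRing A] [Module 𝕜 A] [IsScalarTower 𝕜 A A] [SMulCommClass 𝕜 A A] [Bornology A]
  [SeparatedConvexBornologicalAlgebra 𝕜 A]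
  [NonUnitalRing B] [Module 𝕜 B] [IsScalarTower 𝕜 B B] [SMulCommClass 𝕜 B B] [Bornology B]
  [SeparatedConvexBornologicalAlgebra 𝕜 B]

omit [IsScalarTower 𝕜 A A] [SMulCommClass 𝕜 A A] [Bornology A]
  [SeparatedConvexBornologicalAlgebra 𝕜 A] in
/-- The disk in the definition of local density approximates all of `B_T`, not only `T`. -/
theorem IsLocallyDense.exists_approx {f : A →ₙₐ[𝕜] B} (hf : IsLocallyDense 𝕜 (range f))
    (T : BoundedDisk 𝕜 B) : ∃ (T' : BoundedDisk 𝕜 B) (h : T.carrier ⊆ T'.carrier),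
      ∀ (w : T.Space) (η : ℝ), 0 < η → ∃ (a : A) (z : T'.Space),
        T'.val z = f a ∧ ‖z - BoundedDisk.inclusion h w‖ ≤ η := by
  obtain ⟨T', hT'⟩ := hf T.carrier T.isBounded
  have h : T.carrier ⊆ T'.carrier := fun v hv => by
    obtain ⟨-, -, -, hv', -⟩ := hT' v hv
    exact hv'
  refine ⟨T', h, fun w η hη => ?_⟩
  obtain ⟨v, hv, hvw⟩ := T.val_mem_smul_norm w
  obtain ⟨y, x, hy, -, hx, hlim⟩ := hT' v hv
  have hw : BoundedDisk.inclusion h w = ((‖w‖ : ℝ) : 𝕜) • y := T'.val_injective (by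
    rw [BoundedDisk.val_inclusion, map_smul, hy, ← hvw])
  have hlim' : Tendsto (fun n => ‖((‖w‖ : ℝ) : 𝕜) • x n - BoundedDisk.inclusion h w‖) atTop
      (𝓝 0) := by
    rw [hw]
    have := ((hlim.const_smul ((‖w‖ : ℝ) : 𝕜)).sub_const (((‖w‖ : ℝ) : 𝕜) • y)).norm
    simpa using this
  obtain ⟨n, hn⟩ := (hlim'.eventually_le_const hη).exists
  obtain ⟨a, ha⟩ := (hx n).1
  exact ⟨((‖w‖ : ℝ) : 𝕜) • a, _, by rw [map_smul, map_smul, ha], hn⟩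

/-- A map from a finite-dimensional space to `B_T` lifts approximately to `A` if its values do: it
suffices to lift a basis. -/
theorem exists_lift_of_finiteDimensional {f : A →ₙₐ[𝕜] B} {T : BoundedDisk 𝕜 B}
    {X : Type*} [NormedAddCommGroup X] [NormedSpace 𝕜 X] [FiniteDimensional 𝕜 X]
    (j : X →L[𝕜] T.Space)
    (hj : ∀ (x : X) (η : ℝ), 0 < η → ∃ (a : A) (z : T.Space), T.val z = f a ∧ ‖z - j x‖ ≤ η)
    {η : ℝ} (hη : 0 < η) :
    ∃ (l : X →ₗ[𝕜] A) (z : X →L[𝕜] T.Space), IsBoundedMap l ∧ (∀ x, T.val (z x) = f (l x)) ∧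
      ‖z - j‖ ≤ η := by
  let b := Module.finBasis 𝕜 X
  obtain ⟨C, hC, hCb⟩ := b.exists_opNorm_le (F := T.Space)
  choose a z haz hz using fun i => hj (b i) (η / C) (by positivity)
  obtain ⟨Q, hQ⟩ := BoundedDisk.exists_superset (𝕜 := 𝕜) (finite_range a).isBounded
  let l' : X →L[𝕜] Q.Space :=
    LinearMap.toContinuousLinearMap (b.constr 𝕜 fun i => Q.ofMem (a i) (hQ (mem_range_self i)))
  let z' : X →L[𝕜] T.Space := LinearMap.toContinuousLinearMap (b.constr 𝕜 z)
  refine ⟨Q.val ∘ₗ (l' : X →ₗ[𝕜] Q.Space), z', fun s hs => ?_, fun x => ?_, ?_⟩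
  · have := Q.isBounded_val_image (l'.lipschitz.isBounded_image hs)
    rwa [image_image] at this
  · have : T.val ∘ₗ (z' : X →ₗ[𝕜] T.Space) =
        (f : A →ₗ[𝕜] B) ∘ₗ Q.val ∘ₗ (l' : X →ₗ[𝕜] Q.Space) := by
      refine b.ext fun i => ?_
      simp [z', l', haz]
    exact LinearMap.congr_fun this x
  · refine (hCb (M := η / C) (by positivity) fun i => ?_).trans (mul_div_cancel₀ _ hC.ne').le
    simpa [z'] using hz i

/-- Finite rank approximations of the inclusion of a compact disk are lifted to `A` by local
density. -/
theorem HasLocalApproximationProperty.hasApproximateLifts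
    (hB : HasLocalApproximationProperty 𝕜 B)
    (hK : ∀ S : Set B, IsBounded S → IsBornRelativelyCompact 𝕜 S) {f : A →ₙₐ[𝕜] B}
    (hf : IsLocallyDense 𝕜 (range f)) : HasApproximateLifts 𝕜 f := by
  intro S
  obtain ⟨P, hP, hSP⟩ := IsBornRelativelyCompact.exists_compact_disk S (hK _ S.isBounded)
  obtain ⟨T, hPT, u, hu, hlim⟩ := hB P hP
  obtain ⟨T', hTT', hdense⟩ := hf.exists_approx T
  refine ⟨T', fun ε hε => ?_⟩
  obtain ⟨n, hn⟩ := ((tendsto_iff_norm_sub_tendsto_zero.1 hlim).eventually_le_const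
    (half_pos hε)).exists
  have := hu n
  let R := LinearMap.range (u n : P.Space →ₗ[𝕜] T.Space)
  let q : P.Space →L[𝕜] R := (u n).codRestrict R fun x => LinearMap.mem_range_self _ x
  have hc : 0 < ‖u n‖ + 1 := by positivity
  obtain ⟨l, z, hl, hlz, hz⟩ := exists_lift_of_finiteDimensional (f := f)
    ((BoundedDisk.inclusion hTT').comp R.subtypeL) (fun x η hη => hdense x η hη)
    (show 0 < ε / 2 / (‖u n‖ + 1) by positivity)
  let k : S.Space →L[𝕜] R := q.comp (BoundedDisk.inclusion hSP)
  refine ⟨l ∘ₗ (k : S.Space →ₗ[𝕜] R), fun s hs => ?_, fun x hx => ?_⟩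
  · have := hl _ (k.lipschitz.isBounded_image hs)
    rwa [image_image] at this
  set y := BoundedDisk.inclusion hSP x with hy
  have hy1 : ‖y‖ ≤ 1 :=
    (BoundedDisk.norm_inclusion_le hSP x).trans ((S.norm_le_one_iff x).2 hx)
  refine ⟨(z - (BoundedDisk.inclusion hTT').comp R.subtypeL) (q y) +
    BoundedDisk.inclusion hTT' ((u n - BoundedDisk.inclusion hPT) y), ?_, ?_⟩
  · have hqy : R.subtypeL (q y) = u n y := rfl
    have hk : k x = q y := rfl
    simp only [sub_apply, ContinuousLinearMap.comp_apply, map_add, map_sub,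
      hlz, hqy, BoundedDisk.val_inclusion, LinearMap.comp_apply]
    simp [hy, hk]
  · have h1 : ‖q y‖ ≤ ‖u n‖ + 1 := by
      have : ‖u n y‖ ≤ ‖u n‖ * ‖y‖ := (u n).le_opNorm y
      change ‖u n y‖ ≤ _
      nlinarith [norm_nonneg (u n)]
    have h2 := (z - (BoundedDisk.inclusion hTT').comp R.subtypeL).le_of_opNorm_le_of_le hz h1
    rw [div_mul_cancel₀ _ hc.ne'] at h2
    have h3 := (BoundedDisk.norm_inclusion_le hTT' _).trans
      ((u n - BoundedDisk.inclusion hPT).le_of_opNorm_le_of_le hn hy1)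
    refine (norm_add_le _ _).trans ?_
    linarith

omit [IsScalarTower 𝕜 A A] [SMulCommClass 𝕜 A A] [SeparatedConvexBornologicalAlgebra 𝕜 A] in
theorem hasApproximateLifts_of_tendsToZeroOn {f : A →ₙₐ[𝕜] B}
    (h : ∀ S : BoundedDisk 𝕜 B, ∃ s : ℕ → S.Space →ₗ[𝕜] A, (∀ n, IsBoundedMap (s n)) ∧
      TendsToZeroOn 𝕜 (fun n x => f (s n x) - S.val x) {x : S.Space | S.val x ∈ S.carrier}) :
    HasApproximateLifts 𝕜 f := by
  intro S
  obtain ⟨s, hs, T, ε, hε, hT⟩ := h S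
  refine ⟨T, fun η hη => ?_⟩
  have habs : Tendsto (fun n => |ε n|) atTop (𝓝 0) := by simpa using hε.abs
  obtain ⟨n, hn⟩ := (habs.eventually_le_const hη).exists
  refine ⟨s n, hs n, fun x hx => ?_⟩
  obtain ⟨y, hy, hyε⟩ := T.exists_val_eq_of_mem_smul (hT n x hx)
  exact ⟨y, hy, hyε.trans hn⟩

end ApproximateLifts

/-! ### Bijectivity on homotopy classes -/

section HomotopyClasses

variable {𝕜 : Type uK} {A : Type uA} {B : Type uB} {D : Type uD} [RCLike 𝕜]
  [NonUnitalRing A] [Module 𝕜 A] [IsScalarTower 𝕜 A A] [SMulCommClass 𝕜 A A] [Bornology A]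
  [SeparatedConvexBornologicalAlgebra 𝕜 A]
  [NonUnitalRing B] [Module 𝕜 B] [IsScalarTower 𝕜 B B] [SMulCommClass 𝕜 B B] [Bornology B]
  [SeparatedConvexBornologicalAlgebra 𝕜 B]
  [NonUnitalRing D] [Module 𝕜 D] [IsScalarTower 𝕜 D D] [SMulCommClass 𝕜 D D] [Bornology D]
  [SeparatedConvexBornologicalAlgebra 𝕜 D] {S : BoundedDisk 𝕜 D}

/-- The homotopy class `c` is an approximate lift of `h` along `f`: it is represented by maps `g`
into `A` for which `f ∘ g` is arbitrarily near `h`, with respect to one bounded disk of `B`. -/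
def IsApproxLiftClass (f : A →ₙₐ[𝕜] B) (h : S.two.Space →ₗ[𝕜] B) (c : HomotopyClasses S A) :
    Prop :=
  ∃ T : BoundedDisk 𝕜 B, ∀ ε : ℝ, 0 < ε → ∃ g : ApproxMultMap S A,
    (Quot.mk _ g : HomotopyClasses S A) = c ∧ IsNear T ε ((f : A →ₗ[𝕜] B) ∘ₗ g.toLin) h

theorem IsApproxLiftClass.self (f : A →ₙₐ[𝕜] B) (g : ApproxMultMap S A) :
    IsApproxLiftClass f ((f : A →ₗ[𝕜] B) ∘ₗ g.toLin) (Quot.mk _ g) := by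
  obtain ⟨T, -⟩ := BoundedDisk.exists_superset (𝕜 := 𝕜) (V := B) isBounded_empty
  exact ⟨T, fun ε hε => ⟨g, rfl, IsNear.self _ hε.le⟩⟩

theorem exists_mk_eq_mk_of_isNear (hA : IsLocallyMultiplicative 𝕜 A)
    (hB : IsLocallyMultiplicative 𝕜 B) (f : A →ₙₐ[𝕜] B)
    (hρ : ∀ s : Set A, IsBounded s → bornSpectralRadius 𝕜 s = bornSpectralRadius 𝕜 (f '' s))
    (h : ApproxMultMap S B) (T : BoundedDisk 𝕜 B) :
    ∃ ε : ℝ, 0 < ε ∧ ∀ g g' : ApproxMultMap S A,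
      IsNear T ε ((f : A →ₗ[𝕜] B) ∘ₗ g.toLin) h.toLin →
      IsNear T ε ((f : A →ₗ[𝕜] B) ∘ₗ g'.toLin) h.toLin →
      (Quot.mk _ g : HomotopyClasses S A) = Quot.mk _ g' := by
  obtain ⟨ε, hε, hε'⟩ := exists_linearHomotopy_of_isNear hA hB f hρ h T
  exact ⟨ε, hε, fun g g' hg hg' =>
    Quot.sound (hε' g.toLin g'.toLin g.isBoundedMap g'.isBoundedMap hg hg')⟩

theorem IsApproxLiftClass.unique (hA : IsLocallyMultiplicative 𝕜 A)
    (hB : IsLocallyMultiplicative 𝕜 B) {f : A →ₙₐ[𝕜] B}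
    (hρ : ∀ s : Set A, IsBounded s → bornSpectralRadius 𝕜 s = bornSpectralRadius 𝕜 (f '' s))
    {h : ApproxMultMap S B} {c c' : HomotopyClasses S A} (hc : IsApproxLiftClass f h.toLin c)
    (hc' : IsApproxLiftClass f h.toLin c') : c = c' := by
  obtain ⟨T, hT⟩ := hc
  obtain ⟨T', hT'⟩ := hc'
  obtain ⟨P, hP, hP'⟩ := BoundedDisk.exists_superset₂ T T'
  obtain ⟨ε, hε, hεP⟩ := exists_mk_eq_mk_of_isNear hA hB f hρ h P
  obtain ⟨g, rfl, hg⟩ := hT ε hε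
  obtain ⟨g', rfl, hg'⟩ := hT' ε hε
  exact hεP g g' (hg.mono hP le_rfl) (hg'.mono hP' le_rfl)

/-- Homotopic maps into `B` have a common approximate lift class: approximate lifts of a homotopy
are homotopies between approximate lifts of its end points. -/
theorem HasApproximateLifts.exists_common_class {f : A →ₙₐ[𝕜] B} (hf : HasApproximateLifts 𝕜 f)
    (hA : IsLocallyMultiplicative 𝕜 A) (hB : IsLocallyMultiplicative 𝕜 B)
    (hρ : ∀ s : Set A, IsBounded s → bornSpectralRadius 𝕜 s = bornSpectralRadius 𝕜 (f '' s))
    {h₀ h₁ : ApproxMultMap S B} (hh : SmoothlyHomotopic h₀ h₁) :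
    ∃ c : HomotopyClasses S A, IsApproxLiftClass f h₀.toLin c ∧ IsApproxLiftClass f h₁.toLin c := by
  obtain ⟨H, hH0, hH1⟩ := hh
  obtain ⟨T, hT⟩ := hf.exists_lift hA hB hρ H
  obtain ⟨ε₀, hε₀, h0⟩ := exists_mk_eq_mk_of_isNear hA hB f hρ h₀ T
  obtain ⟨ε₁, hε₁, h1⟩ := exists_mk_eq_mk_of_isNear hA hB f hρ h₁ T
  have e0 : SmoothPath.evalComp H.toLin 0 = h₀.toLin := LinearMap.ext hH0
  have e1 : SmoothPath.evalComp H.toLin 1 = h₁.toLin := LinearMap.ext hH1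
  let ev : I → ApproxMultMap S (SmoothPath 𝕜 A) → ApproxMultMap S A :=
    fun t G => G.map (SmoothPath.eval t) (SmoothPath.isBoundedMap_eval t)
  have hev : ∀ G, (Quot.mk _ (ev 0 G) : HomotopyClasses S A) = Quot.mk _ (ev 1 G) :=
    fun G => Quot.sound ⟨G, fun _ => rfl, fun _ => rfl⟩
  obtain ⟨G, hG⟩ := hT (min ε₀ ε₁) (lt_min hε₀ hε₁)
  have hG0 := hG 0
  have hG1 := hG 1
  rw [e0] at hG0
  rw [e1] at hG1
  -- All lifts of `H` that are at least as near as `G` have end points in the class of `G` at `0`.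
  have key : ∀ ε : ℝ, 0 < ε → ∃ G' : ApproxMultMap S (SmoothPath 𝕜 A),
      ((Quot.mk _ (ev 0 G') : HomotopyClasses S A) = Quot.mk _ (ev 0 G) ∧
        IsNear T ε ((f : A →ₗ[𝕜] B) ∘ₗ (ev 0 G').toLin) h₀.toLin) ∧
      ((Quot.mk _ (ev 1 G') : HomotopyClasses S A) = Quot.mk _ (ev 0 G) ∧
        IsNear T ε ((f : A →ₗ[𝕜] B) ∘ₗ (ev 1 G').toLin) h₁.toLin) := by
    intro ε hε
    obtain ⟨G', hG'⟩ := hT (min ε (min ε₀ ε₁)) (lt_min hε (lt_min hε₀ hε₁))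
    have hG'0 := hG' 0
    have hG'1 := hG' 1
    rw [e0] at hG'0
    rw [e1] at hG'1
    refine ⟨G', ⟨h0 (ev 0 G') (ev 0 G) ?_ ?_, ?_⟩, ⟨(h1 (ev 1 G') (ev 1 G) ?_ ?_).trans
      (hev G).symm, ?_⟩⟩
    · exact hG'0.mono subset_rfl ((min_le_right _ _).trans (min_le_left _ _))
    · exact hG0.mono subset_rfl (min_le_left _ _)
    · exact hG'0.mono subset_rfl (min_le_left _ _)
    · exact hG'1.mono subset_rfl ((min_le_right _ _).trans (min_le_right _ _))
    · exact hG1.mono subset_rfl (min_le_right _ _)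
    · exact hG'1.mono subset_rfl (min_le_left _ _)
  refine ⟨Quot.mk _ (ev 0 G), ⟨T, fun ε hε => ?_⟩, ⟨T, fun ε hε => ?_⟩⟩
  · obtain ⟨G', h, -⟩ := key ε hε
    exact ⟨_, h⟩
  · obtain ⟨G', -, h⟩ := key ε hε
    exact ⟨_, h⟩

theorem smoothlyHomotopic_refl (hB : IsLocallyMultiplicative 𝕜 B) (h : ApproxMultMap S B) :
    SmoothlyHomotopic h h := by
  obtain ⟨T, -⟩ := BoundedDisk.exists_superset (𝕜 := 𝕜) (V := B) isBounded_empty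
  obtain ⟨ε, hε, H⟩ := exists_linearHomotopy_of_isNear hB hB (NonUnitalAlgHom.id 𝕜 B)
    (fun s _ => by simp) h T
  exact H _ _ h.isBoundedMap h.isBoundedMap (IsNear.self _ hε.le) (IsNear.self _ hε.le)

theorem HasApproximateLifts.bijective_map {f : A →ₙₐ[𝕜] B} (hlift : HasApproximateLifts 𝕜 f)
    (hA : IsLocallyMultiplicative 𝕜 A) (hB : IsLocallyMultiplicative 𝕜 B) (hf : IsBoundedMap f)
    (hρ : ∀ s : Set A, IsBounded s → bornSpectralRadius 𝕜 s = bornSpectralRadius 𝕜 (f '' s)) :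
    Function.Bijective (HomotopyClasses.map S f hf) := by
  constructor
  · rintro ⟨g⟩ ⟨g'⟩ hgg'
    have hiff : ∀ h h' : ApproxMultMap S B, Relation.EqvGen SmoothlyHomotopic h h' →
        ∀ c : HomotopyClasses S A,
          IsApproxLiftClass f h.toLin c ↔ IsApproxLiftClass f h'.toLin c := by
      intro h h' hh
      induction hh with
      | rel h h' hh =>
        obtain ⟨c₀, hc₀, hc₀'⟩ := hlift.exists_common_class hA hB hρ hh
        intro c
        constructor
        · intro hc
          rwa [hc.unique hA hB hρ hc₀]
        · intro hc
          rwa [hc.unique hA hB hρ hc₀']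
      | refl h => exact fun _ => Iff.rfl
      | symm h h' _ ih => exact fun c => (ih c).symm
      | trans h h' h'' _ _ ih ih' => exact fun c => (ih c).trans (ih' c)
    have h1 := (hiff _ _ (Quot.eqvGen_exact hgg') _).1 (IsApproxLiftClass.self f g)
    exact IsApproxLiftClass.unique (h := g'.map f hf) hA hB hρ h1 (IsApproxLiftClass.self f g')
  · rintro ⟨h⟩
    obtain ⟨c, ⟨T, hT⟩, -⟩ :=
      hlift.exists_common_class hA hB hρ (smoothlyHomotopic_refl hB h)
    obtain ⟨ε, hε, hεT⟩ := exists_mk_eq_mk_of_isNear hB hB (NonUnitalAlgHom.id 𝕜 B)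
      (fun s _ => by simp) h T
    obtain ⟨g, -, hg⟩ := hT ε hε
    exact ⟨Quot.mk _ g, hεT (g.map f hf) h hg (IsNear.self _ hε.le)⟩

end HomotopyClasses

theorem mainTheorem1 {𝕜 : Type uK} {A : Type uA} {B : Type uB} [RCLike 𝕜]
    [NonUnitalRing A] [Module 𝕜 A] [IsScalarTower 𝕜 A A] [SMulCommClass 𝕜 A A] [Bornology A]
    [SeparatedConvexBornologicalAlgebra 𝕜 A]
    [NonUnitalRing B] [Module 𝕜 B] [IsScalarTower 𝕜 B B] [SMulCommClass 𝕜 B B] [Bornology B]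
    [SeparatedConvexBornologicalAlgebra 𝕜 B]
    (hA : IsCompleteBornological 𝕜 A) (hB : IsCompleteBornological 𝕜 B)
    (hA' : IsLocallyMultiplicative 𝕜 A) (hB' : IsLocallyMultiplicative 𝕜 B)
    (f : A →ₙₐ[𝕜] B) (hf : IsBoundedMap f) (hiso : IsIsoradial f)
    (happrox :
      ((∀ S : Set B, IsBounded S → IsBornRelativelyCompact 𝕜 S) ∧
        HasLocalApproximationProperty 𝕜 B) ∨
      (∀ S : BoundedDisk 𝕜 B, ∃ s : ℕ → S.Space →ₗ[𝕜] A, (∀ n, IsBoundedMap (s n)) ∧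
        TendsToZeroOn 𝕜 (fun n x => f (s n x) - S.val x) {x : S.Space | S.val x ∈ S.carrier})) :
    IsApproxLocalHomotopyEquiv.{uK, uA, uB, uD} f hf := by
  intro D _ _ _ _ _ _ S
  have hlift : HasApproximateLifts 𝕜 f := by
    rcases happrox with ⟨hK, hLAP⟩ | h
    · exact hLAP.hasApproximateLifts hK hiso.1
    · exact hasApproximateLifts_of_tendsToZeroOn h
  exact hlift.bijective_map hA' hB' hf hiso.2
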